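/- **Setting.** Let $d\ge 1$, let $\mathbb B(\mathbb Z^d)$ be the set of unordered nearest-neighbour edges of $\mathbb Z^d$, and let $\Omega=(0,1]^{\mathbb B(\mathbb Z^d)}$ carry the product $\sigma$-algebra. For $\omega\in\Omega$ put $\pi_\omega(x)=\sum_{z:|z-x|=1}\omega_{xz}$ and let $P_\omega^x$ be the law of the Markov chain $(X_n)_{n\ge0}$ on $\mathbb Z^d$ started at $x$ with transition kernel $\mathsf P_\omega(x,y)=\omega_{xy}/\pi_\omega(x)$ (zero unless $|x-y|=1$); $\mathsf P_\omega^n$ is the $n$-fold product of $\mathsf P_\omega$. Let $(\tau_x\omega)_{yz}=\omega_{y+x,z+x}$. For $\alpha>0$ let $\mathscr C_{\infty,\alpha}=\mathscr C_{\infty,\alpha}(\omega)$ be the set of vertices lying on an infinite self-avoiding path of edges $b$ with $\omega_b\ge\alpha$. For $y\notin\mathscr C_{\infty,\alpha}$ let $\mathscr F_y$ be the connected component containing $y$ of $\mathbb Z^d\setminus\mathscr C_{\infty,\alpha}$ (with the graph structure of $\mathbb Z^d$); for $y\in\mathscr C_{\infty,\alpha}$ let $\mathscr F_y=\{y\}$.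 Let $\mathcal G_x=\bigcup_{y:|y-x|=1}\mathscr F_y$. With $T_1=\inf\{n\ge1: X_n\in\mathscr C_{\infty,\alpha}\}$, let $\hat{\mathsf P}_\omega(x,y)=P_\omega^x(T_1<\infty,\,X_{T_1}=y)$ for $x,y\in\mathscr C_{\infty,\alpha}$, let $\hat{\mathsf P}^n_\omega$ be its $n$-fold product over $\mathscr C_{\infty,\alpha}$, and let $\mathrm d_\omega(x,y)=\inf\{n\ge0:\hat{\mathsf P}_\omega^n(x,y)>0\}$. **Assumptions** on a probability measure $\mathbb P$ on $\Omega$: * $\mathbb P$ is invariant and jointly ergodic with respect to the shifts $(\tau_x)_{x\in\mathbb Z^d}$. * For $\mathbb P$-a.e. $\omega$, $\bigcup_{\alpha>0}\mathscr C_{\infty,\alpha}(\omega)=\mathbb Z^d$. Put $\alpha_1=\inf\{\alpha>0:\mathbb P(0\in\mathscr C_{\infty,\alpha})=0\}$ and, for $\alpha\in(0,\alpha_1)$, $\mathbb P_\alpha=\mathbb P(\,\cdot\mid 0\in\mathscr C_{\infty,\alpha})$. * There is $\alpha\in(0,\alpha_1)$ such that $|\mathcal G_0|\in L^p(\mathbb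 P_\alpha)$ for all $1\le p<\infty$. Let $\alpha_2$ be the supremum of all such $\alpha$. * There is $\alpha_0\in(0,\alpha_2]$ such that for each $\alpha\in(0,\alpha_0)$ and each $\rho>0$, for $\mathbb P_\alpha$-a.e. $\omega$ there is $C(\omega)<\infty$ such that for all $n\ge1$ and all $x,y\in\mathscr C_{\infty,\alpha}$ with $\mathrm d_\omega(0,x)\le\rho n$, $$\hat{\mathsf P}_\omega^n(x,y)\le\frac{C(\omega)}{n^{d/2}}.$$ **Theorem.** Under these assumptions: 1. if $d=4$, then for $\mathbb P$-a.e. $\omega$, $\ \mathsf P_\omega^{2n}(0,0)=o(n^{-2}\log n)$ as $n\to\infty$; 2. if $d\ge5$, then for $\mathbb P$-a.e. $\omega$, $\ n^2\,\mathsf P_\omega^{2n}(0,0)\to0$ as $n\to\infty$. -/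

import Mathlib

open MeasureTheory ProbabilityTheory Filter Asymptotics Topology
open scoped ENNReal

noncomputable section

namespace RandomConductance

/-- The nearest-neighbour graph on `ℤ^d`: `x ∼ y` iff `|x - y| = 1`. -/
def lattice (d : ℕ) : SimpleGraph (Fin d → ℤ) where
  Adj x y := ∑ i, |x i - y i| = 1
  symm := ⟨fun x y h => by simpa only [abs_sub_comm] using h⟩
  loopless := ⟨fun x h => by simp at h⟩

/-- The space `Ω = (0,1]^{𝔹(ℤ^d)}` of conductance configurations indexed by unordered edges.
It carries the product σ-algebra (the instance for function types). -/
abbrev Env (d : ℕ) : Type := (lattice d).edgeSet → Set.Ioc (0 : ℝ) 1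

/-- Translation by `x` as a homomorphism of the lattice graph. -/
def translate {d : ℕ} (x : Fin d → ℤ) : lattice d →g lattice d where
  toFun y := y + x
  map_rel' := fun {a b} h => by simpa [lattice] using h

/-- The shift `(τ_x ω)_{y,z} = ω_{y+x,z+x}`. -/
def shift {d : ℕ} (x : Fin d → ℤ) (ω : Env d) : Env d :=
  fun e => ω ((translate x).mapEdgeSet e)

open Classical in
/-- The conductance `ω_{xy}`, with the convention that it is `0` if `x`, `y` are not neighbours. -/
def conductance {d : ℕ} (ω : Env d) (x y : Fin d → ℤ) : ℝ :=
  if h : (lattice d).Adj x y then (ω ⟨s(x, y), h⟩ : ℝ) else 0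

/-- `π_ω(x) = ∑_{z : |z - x| = 1} ω_{xz}` (only finitely many terms are nonzero). -/
def totalConductance {d : ℕ} (ω : Env d) (x : Fin d → ℤ) : ℝ :=
  ∑' z, conductance ω x z

/-- The transition kernel `P_ω(x,y) = ω_{xy} / π_ω(x)`. -/
def transProb {d : ℕ} (ω : Env d) (x y : Fin d → ℤ) : ℝ :=
  conductance ω x y / totalConductance ω x

/-- The `n`-fold product of a transition kernel on `ℤ^d`. -/
def nFold {d : ℕ} (p : (Fin d → ℤ) → (Fin d → ℤ) → ℝ) : ℕ → (Fin d → ℤ) → (Fin d → ℤ) → ℝ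
  | 0 => fun x y => if x = y then 1 else 0
  | n + 1 => fun x y => ∑' z, p x z * nFold p n z y

/-! ### The law of the random walk -/

lemma neighborSet_finite {d : ℕ} (x : Fin d → ℤ) : ((lattice d).neighborSet x).Finite := by
  refine (Set.Finite.pi' (t := fun i => Set.Icc (x i - 1) (x i + 1))
    fun i => Set.finite_Icc _ _).subset ?_
  intro y hy i
  have hy' : ∑ i, |x i - y i| = 1 := hy
  have h : |x i - y i| ≤ 1 := by
    rw [← hy']
    exact Finset.single_le_sum (f := fun i => |x i - y i|) (fun _ _ => abs_nonneg _)
      (Finset.mem_univ i)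
  rw [abs_le] at h
  exact ⟨by omega, by omega⟩

lemma conductance_nonneg {d : ℕ} (ω : Env d) (x y : Fin d → ℤ) : 0 ≤ conductance ω x y := by
  unfold conductance
  split_ifs with h
  · exact (ω ⟨s(x, y), h⟩).2.1.le
  · exact le_rfl

lemma summable_conductance {d : ℕ} (ω : Env d) (x : Fin d → ℤ) :
    Summable (conductance ω x) := by
  refine summable_of_hasFiniteSupport ((neighborSet_finite x).subset fun y hy => ?_)
  by_contra h
  exact hy (dif_neg h)

lemma totalConductance_pos {d : ℕ} [NeZero d] (ω : Env d) (x : Fin d → ℤ) :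
    0 < totalConductance ω x := by
  have h : (lattice d).Adj x (x + Pi.single 0 1) := by
    simp only [lattice, Pi.add_apply, sub_add_cancel_left, abs_neg]
    rw [Finset.sum_eq_single 0] <;> simp +contextual
  refine (summable_conductance ω x).tsum_pos (conductance_nonneg ω x) (x + Pi.single 0 1) ?_
  rw [conductance, dif_pos h]
  exact (ω _).2.1

/-- One step of the walk from `x`: the probability measure with weights `P_ω(x,y)`. -/
def stepMeasure {d : ℕ} (ω : Env d) (x : Fin d → ℤ) : Measure (Fin d → ℤ) :=
  Measure.sum fun y => ENNReal.ofReal (transProb ω x y) • Measure.dirac y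

instance {d : ℕ} [NeZero d] (ω : Env d) (x : Fin d → ℤ) :
    IsProbabilityMeasure (stepMeasure ω x) := by
  constructor
  have h := totalConductance_pos ω x
  rw [stepMeasure, Measure.sum_apply _ MeasurableSet.univ]
  simp only [Measure.smul_apply, measure_univ, smul_eq_mul, mul_one, transProb]
  rw [← ENNReal.ofReal_tsum_of_nonneg
    (fun y => div_nonneg (conductance_nonneg ω x y) h.le)
    ((summable_conductance ω x).div_const _)]
  rw [tsum_div_const]
  rw [← totalConductance, div_self h.ne', ENNReal.ofReal_one]

/-- The Markov kernel of one step of the walk. -/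
def stepKernel {d : ℕ} (ω : Env d) : Kernel (Fin d → ℤ) (Fin d → ℤ) :=
  Kernel.ofFunOfCountable (stepMeasure ω)

instance {d : ℕ} [NeZero d] (ω : Env d) : IsMarkovKernel (stepKernel ω) :=
  ⟨fun x => inferInstanceAs (IsProbabilityMeasure (stepMeasure ω x))⟩

/-- The law `P_ω^x` of the path `(X_n)_{n ≥ 0}` of the walk started at `x`: the Markov chain with
one-step kernel `stepKernel ω`. -/
def pathLaw {d : ℕ} [NeZero d] (ω : Env d) (x : Fin d → ℤ) : Measure (ℕ → (Fin d → ℤ)) :=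
  Kernel.traj (X := fun _ => Fin d → ℤ)
    (fun n => (stepKernel ω).comap (fun h => h ⟨n, Finset.mem_Iic.2 le_rfl⟩)
      (measurable_pi_apply _)) 0 (fun _ => x)

/-! ### The strong component and the coarse-grained walk -/

/-- `𝒞_{∞,α}(ω)`: the vertices that lie on an infinite self-avoiding path of edges with
conductance at least `α`. -/
def strongComponent {d : ℕ} (ω : Env d) (α : ℝ) : Set (Fin d → ℤ) :=
  {x | ∃ γ : ℕ → (Fin d → ℤ), Function.Injective γ ∧ x ∈ Set.range γ ∧
    ∀ k, ∃ h : (lattice d).Adj (γ k) (γ (k + 1)), α ≤ (ω ⟨s(γ k, γ (k + 1)), h⟩ : ℝ)}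

open Classical in
/-- `ℱ_y`: for `y ∉ 𝒞_{∞,α}`, the connected component containing `y` of the complement of
`𝒞_{∞,α}`, as a subgraph of `ℤ^d`; for `y ∈ 𝒞_{∞,α}`, the singleton `{y}`. -/
def weakComponent {d : ℕ} (ω : Env d) (α : ℝ) (y : Fin d → ℤ) : Set (Fin d → ℤ) :=
  if hy : y ∈ (strongComponent ω α)ᶜ then
    {z | ∃ hz : z ∈ (strongComponent ω α)ᶜ,
      ((lattice d).induce (strongComponent ω α)ᶜ).Reachable ⟨y, hy⟩ ⟨z, hz⟩}
  else {y}

/-- `𝒢_x`: the union of `ℱ_y` over the neighbours `y` of `x`. -/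
def weakNeighborhood {d : ℕ} (ω : Env d) (α : ℝ) (x : Fin d → ℤ) : Set (Fin d → ℤ) :=
  ⋃ y ∈ (lattice d).neighborSet x, weakComponent ω α y

/-- The event `{T_1 < ∞, X_{T_1} = y}` where `T_1 ≥ 1` is the first positive time at which the
path visits the set `S`. -/
def firstReturnAt {d : ℕ} (S : Set (Fin d → ℤ)) (y : Fin d → ℤ) : Set (ℕ → (Fin d → ℤ)) :=
  {X | ∃ n, 1 ≤ n ∧ X n ∈ S ∧ (∀ m, 1 ≤ m → m < n → X m ∉ S) ∧ X n = y}

/-- The transition kernel `P̂_ω(x,y) = P_ω^x(X_{T_1} = y)` of the coarse-grained walk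
on `𝒞_{∞,α}`. It vanishes for `y ∉ 𝒞_{∞,α}`, so that `nFold` of it, started in `𝒞_{∞,α}`, is the
`n`-fold product over `𝒞_{∞,α}`. -/
def coarseTransProb {d : ℕ} [NeZero d] (ω : Env d) (α : ℝ) (x y : Fin d → ℤ) : ℝ :=
  (pathLaw ω x).real (firstReturnAt (strongComponent ω α) y)

/-- The Markov distance `d_ω(x,y) = inf {n ≥ 0 : P̂_ω^n(x,y) > 0}`, equal to `⊤` if there is no
such `n`. -/
def markovDist {d : ℕ} [NeZero d] (ω : Env d) (α : ℝ) (x y : Fin d → ℤ) : ℕ∞ :=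
  ⨅ (n : ℕ) (_ : 0 < nFold (coarseTransProb ω α) n x y), (n : ℕ∞)

/-! ### The assumptions on the environment law -/

/-- The law is jointly ergodic with respect to the shifts `(τ_x)_{x ∈ ℤ^d}`. -/
structure ErgodicLaw {d : ℕ} (P : Measure (Env d)) : Prop where
  measurePreserving : ∀ x : Fin d → ℤ, MeasurePreserving (shift x) P P
  zero_one : ∀ A : Set (Env d), MeasurableSet A → (∀ x : Fin d → ℤ, shift x ⁻¹' A = A) →
    P A = 0 ∨ P A = 1

/-- Almost surely, the sets `𝒞_{∞,α}`, `α > 0`, exhaust `ℤ^d`. -/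
def StrongComponentsExhaust {d : ℕ} (P : Measure (Env d)) : Prop :=
  ∀ᵐ ω ∂P, ⋃ α ∈ Set.Ioi (0 : ℝ), strongComponent ω α = Set.univ

/-- The event `{0 ∈ 𝒞_{∞,α}}`. -/
def originStrong (d : ℕ) (α : ℝ) : Set (Env d) :=
  {ω | (0 : Fin d → ℤ) ∈ strongComponent ω α}

/-- `α_1 = inf {α > 0 : ℙ(0 ∈ 𝒞_{∞,α}) = 0}`. -/
def alpha1 {d : ℕ} (P : Measure (Env d)) : ℝ :=
  sInf {α : ℝ | 0 < α ∧ P (originStrong d α) = 0}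

/-- The conditional law `ℙ_α = ℙ( · | 0 ∈ 𝒞_{∞,α})`. -/
def condLaw {d : ℕ} (P : Measure (Env d)) (α : ℝ) : Measure (Env d) :=
  ProbabilityTheory.cond P (originStrong d α)

/-- `|𝒢_0| ∈ L^p(ℙ_α)` for all `1 ≤ p < ∞`, with `|𝒢_0| = ∞` allowed as a value. -/
def WeakMoments {d : ℕ} (P : Measure (Env d)) (α : ℝ) : Prop :=
  ∀ p : ℝ, 1 ≤ p →
    ∫⁻ ω, ((weakNeighborhood ω α 0).encard : ℝ≥0∞) ^ p ∂(condLaw P α) < ∞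

/-- There is `α ∈ (0, α_1)` for which `|𝒢_0|` has all moments under `ℙ_α`. -/
def HasWeakMoments {d : ℕ} (P : Measure (Env d)) : Prop :=
  ∃ α ∈ Set.Ioo 0 (alpha1 P), WeakMoments P α

/-- `α_2 = sup {α ∈ (0, α_1) : |𝒢_0| has all moments under ℙ_α}`. -/
def alpha2 {d : ℕ} (P : Measure (Env d)) : ℝ :=
  sSup {α : ℝ | α ∈ Set.Ioo 0 (alpha1 P) ∧ WeakMoments P α}

/-- The diffusive upper bound on the coarse-grained walk: there is `α_0 ∈ (0, α_2]` such that for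
all `α ∈ (0, α_0)` and `ρ > 0`, for `ℙ_α`-a.e. `ω` there is `C(ω) < ∞` such that
`P̂_ω^n(x,y) ≤ C(ω) / n^{d/2}` for all `n ≥ 1` and all `x, y ∈ 𝒞_{∞,α}` with `d_ω(0,x) ≤ ρ n`. -/
def CoarseHeatKernelBound {d : ℕ} [NeZero d] (P : Measure (Env d)) : Prop :=
  ∃ α₀ ∈ Set.Ioc 0 (alpha2 P), ∀ α ∈ Set.Ioo 0 α₀, ∀ ρ : ℝ, 0 < ρ →
    ∀ᵐ ω ∂(condLaw P α), ∃ C : ℝ, ∀ n : ℕ, 1 ≤ n →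
      ∀ x ∈ strongComponent ω α, (markovDist ω α 0 x : ℝ≥0∞) ≤ ENNReal.ofReal (ρ * n) →
        ∀ y ∈ strongComponent ω α,
          nFold (coarseTransProb ω α) n x y ≤ C / (n : ℝ) ^ ((d : ℝ) / 2)

end RandomConductance

end

open RandomConductance

/-!
# Anomalous heat kernel decay in dimension four and higher

Write `p` for the kernel of the walk, `C` for the strong component `𝒞_{∞,α}`, `q` for the kernel
of the coarse-grained walk and `T_l` for the time of the `l`-th return to `C`. For almost every
`ω` there is some `α < α₀` with `0 ∈ C`, and such `α` and `ω` are fixed in the quenched part of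
the argument.

The probabilities `p ^ (2 n) (0, 0)` are nonincreasing in `n` by reversibility, so
`N p ^ (2 N) (0, 0)` is at most twice the expected number of visits to `0` in the window `[N, 2 N]`
(`mul_kpow_two_mul_le`). Every visit to `0` is a return to `C`, and `T_l ≥ l`, so this number is a
sum over `l ≤ 2 N` of probabilities that `T_l ∈ [N, 2 N]` and `X_{T_l} = 0`. For `l` of order at
least `N` these are bounded by `q ^ l (0, 0) = O(l ^ (-d / 2))`. For the other `l`, only the
excursions of duration at least `k`, a constant that is at most `N / (2 l)`, can be responsible
for `T_l ≥ N`, and Markov's inequality (`sub_mul_visit_le`) bounds the probability by a multiple of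
`1 / N` times the mean total duration of these long excursions on `X_{T_l} = 0`. Splitting that path
at the long excursion and applying the heat kernel bound to the longer of the two remaining
pieces, reversed in time if needed, one gets a factor `l ^ (-d / 2)` times the mean total duration
of the long excursions among the first `l`, without the constraint at the end (`excursionSum_le`).

The mean of the latter is `∑_{j < l} Q ^ j u_k`, where `Q` is the transition operator of the
environment seen from the coarse-grained walk and `u_k` is the mean duration of an excursion from
the origin, restricted to durations at least `k`. The operator `Q` contracts the integral with
respect to `π_ω(0) 1{0 ∈ C} ℙ(dω)`, and `u_0` is integrable by Kac's formula, a consequence of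
reversibility and mass transport (`lintegral_tsum_excursionMean_ne_top`); hence `u_k → 0` in mean
as `k → ∞`. Hopf's maximal inequality (`mul_measure_exists_lt_sum_iterate_le`) then shows that
almost surely for every `ε > 0` there is `k` with `∑_{j < l} Q ^ j u_k ≤ ε l` for all `l` at once.

Altogether `N ^ 2 p ^ (2 N) (0, 0)` is at most a constant times
`ε ∑_{l ≤ 2 N} l ^ (1 - d / 2) + k ∑_{N / 2 k < l ≤ 2 N} l ^ (1 - d / 2)`. The first sum is of order
`log N` for `d = 4` and bounded for `d ≥ 5`; the second is bounded for `d = 4` and tends to zero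
for `d ≥ 5` (`isLittleO_of_visit_bounds`).

All kernels take values in `[0, ∞]`, which makes sums and their rearrangement unconditional; the
path measure enters only through the identification of `coarseTransProb` with a sum of taboo
kernels (`coarseTransProb_eq_toReal`).
-/

namespace RandomConductance

/-! ### Powers of kernels and reversibility -/

section KernelAlgebra

variable {V : Type*}

open Classical in
/-- The `n`-fold product of a kernel with values in `[0, ∞]`. -/
noncomputable def kpow (K : V → V → ℝ≥0∞) : ℕ → V → V → ℝ≥0∞
  | 0 => fun x y => if x = y then 1 else 0
  | n + 1 => fun x y => ∑' z, K x z * kpow K n z y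

lemma tsum_kpow_zero_mul (K : V → V → ℝ≥0∞) (f : V → ℝ≥0∞) (x : V) :
    ∑' z, kpow K 0 x z * f z = f x := by
  classical
  rw [tsum_eq_single x]
  · simp [kpow]
  · intro z hz
    simp [kpow, hz.symm]

lemma tsum_mul_kpow_zero (K : V → V → ℝ≥0∞) (f : V → ℝ≥0∞) (x : V) :
    ∑' z, f z * kpow K 0 z x = f x := by
  classical
  rw [tsum_eq_single x]
  · simp [kpow]
  · intro z hz
    simp [kpow, hz]

lemma kpow_one (K : V → V → ℝ≥0∞) (x y : V) : kpow K 1 x y = K x y :=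
  tsum_mul_kpow_zero K (K x) y

/-- Associativity of the composition of kernels with values in `[0, ∞]`. -/
lemma tsum_tsum_mul_assoc (A B : V → V → ℝ≥0∞) (f : V → ℝ≥0∞) (x : V) :
    ∑' z, A x z * ∑' w, B z w * f w = ∑' w, (∑' z, A x z * B z w) * f w := by
  simp_rw [← ENNReal.tsum_mul_left, ← ENNReal.tsum_mul_right]
  rw [ENNReal.tsum_comm]
  simp_rw [mul_assoc]

lemma kpow_add (K : V → V → ℝ≥0∞) (m n : ℕ) (x y : V) :
    kpow K (m + n) x y = ∑' z, kpow K m x z * kpow K n z y := by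
  induction m generalizing x with
  | zero => rw [zero_add, tsum_kpow_zero_mul]
  | succ m ih =>
    rw [Nat.add_right_comm]
    simp only [kpow, ih]
    exact tsum_tsum_mul_assoc K (kpow K m) (fun w => kpow K n w y) x

lemma kpow_succ' (K : V → V → ℝ≥0∞) (n : ℕ) (x y : V) :
    kpow K (n + 1) x y = ∑' z, kpow K n x z * K z y := by
  simp_rw [kpow_add, kpow_one]

/-- The products of a reversible kernel are reversible for the same weight. -/
lemma kpow_symm {K : V → V → ℝ≥0∞} {r : V → ℝ≥0∞} (h : ∀ x y, r x * K x y = r y * K y x)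
    (n : ℕ) (x y : V) : r x * kpow K n x y = r y * kpow K n y x := by
  induction n generalizing x y with
  | zero =>
    by_cases hxy : x = y
    · rw [hxy]
    · simp [kpow, hxy, Ne.symm hxy]
  | succ n ih =>
    rw [kpow_succ' K n y x]
    simp only [kpow, ← ENNReal.tsum_mul_left]
    refine tsum_congr fun z => ?_
    rw [← mul_assoc, h, mul_right_comm, ih, mul_assoc]

lemma tsum_kpow_le_one {K : V → V → ℝ≥0∞} (h : ∀ x, ∑' y, K x y ≤ 1) (n : ℕ) (x : V) :
    ∑' y, kpow K n x y ≤ 1 := by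
  induction n generalizing x with
  | zero => simpa using (tsum_kpow_zero_mul K (fun _ => 1) x).le
  | succ n ih =>
    simp only [kpow]
    rw [ENNReal.tsum_comm]
    simp_rw [ENNReal.tsum_mul_left]
    exact (ENNReal.tsum_le_tsum fun z => mul_le_of_le_one_right' (ih z)).trans (h x)

lemma kpow_le_one {K : V → V → ℝ≥0∞} (h : ∀ x, ∑' y, K x y ≤ 1) (n : ℕ) (x y : V) :
    kpow K n x y ≤ 1 :=
  (ENNReal.le_tsum y).trans (tsum_kpow_le_one h n x)

lemma two_mul_mul_le_sq_add_sq (a b : ℝ≥0∞) : 2 * (a * b) ≤ a ^ 2 + b ^ 2 := by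
  rcases eq_or_ne a ∞ with rfl | ha
  · simp
  rcases eq_or_ne b ∞ with rfl | hb
  · simp
  lift a to NNReal using ha
  lift b to NNReal using hb
  norm_cast
  rw [← mul_assoc]
  exact two_mul_le_add_sq a b

/-- For a reversible sub-Markov kernel the even return probabilities are nonincreasing: in terms of
`g z = K ^ n (z, o)` the weighted value at time `2 n + 2` is the quadratic form
`∑ r y K² (y, z) g y g z`, which is at most `∑ r y (g y) ^ 2`, the weighted value at time `2 n`. -/
lemma kpow_even_succ_le {K : V → V → ℝ≥0∞} {r : V → ℝ≥0∞} (h : ∀ x y, r x * K x y = r y * K y x)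
    (h1 : ∀ x, ∑' y, K x y ≤ 1) {o : V} (h0 : r o ≠ 0) (htop : r o ≠ ∞) (n : ℕ) :
    kpow K (2 * (n + 1)) o o ≤ kpow K (2 * n) o o := by
  set g : V → ℝ≥0∞ := fun z => kpow K n z o
  have hg (z : V) : r o * kpow K n o z = r z * g z := kpow_symm h n o z
  have hE : r o * kpow K (2 * n) o o = ∑' z, r z * g z ^ 2 := by
    rw [two_mul, kpow_add, ← ENNReal.tsum_mul_left]
    refine tsum_congr fun z => ?_
    rw [← mul_assoc, hg, sq, mul_assoc]
  have hS : r o * kpow K (2 * (n + 1)) o o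
      = ∑' y, ∑' z, r y * kpow K 2 y z * (g y * g z) := by
    rw [show 2 * (n + 1) = n + (2 + n) by ring, kpow_add, ← ENNReal.tsum_mul_left]
    refine tsum_congr fun y => ?_
    rw [← mul_assoc, hg, kpow_add, ← ENNReal.tsum_mul_left]
    refine tsum_congr fun z => ?_
    ring
  have hB : ∑' y, ∑' z, r y * kpow K 2 y z * g y ^ 2 ≤ ∑' z, r z * g z ^ 2 := by
    refine ENNReal.tsum_le_tsum fun y => ?_
    simp_rw [mul_right_comm (r y) _ (g y ^ 2)]
    rw [ENNReal.tsum_mul_left]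
    exact mul_le_of_le_one_right' (tsum_kpow_le_one h1 2 y)
  have hB' : ∑' y, ∑' z, r y * kpow K 2 y z * g z ^ 2 ≤ ∑' z, r z * g z ^ 2 := by
    rw [ENNReal.tsum_comm]
    simp_rw [kpow_symm h 2]
    exact hB
  have h2 : 2 * (r o * kpow K (2 * (n + 1)) o o) ≤ 2 * (r o * kpow K (2 * n) o o) := by
    rw [hS, hE]
    calc 2 * ∑' y, ∑' z, r y * kpow K 2 y z * (g y * g z)
        = ∑' y, ∑' z, r y * kpow K 2 y z * (2 * (g y * g z)) := by
          simp_rw [← ENNReal.tsum_mul_left]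
          refine tsum_congr fun y => tsum_congr fun z => ?_
          ring
      _ ≤ ∑' y, ∑' z, (r y * kpow K 2 y z * g y ^ 2 + r y * kpow K 2 y z * g z ^ 2) := by
          refine ENNReal.tsum_le_tsum fun y => ENNReal.tsum_le_tsum fun z => ?_
          rw [← mul_add]
          gcongr
          exact two_mul_mul_le_sq_add_sq _ _
      _ ≤ 2 * ∑' z, r z * g z ^ 2 := by
          simp_rw [ENNReal.tsum_add]
          rw [two_mul]
          exact add_le_add hB hB'
  rwa [ENNReal.mul_le_mul_iff_right (by simp) (by simp),
    ENNReal.mul_le_mul_iff_right h0 htop] at h2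

lemma kpow_even_antitone {K : V → V → ℝ≥0∞} {r : V → ℝ≥0∞}
    (h : ∀ x y, r x * K x y = r y * K y x) (h1 : ∀ x, ∑' y, K x y ≤ 1) {o : V} (h0 : r o ≠ 0)
    (htop : r o ≠ ∞) : Antitone fun n => kpow K (2 * n) o o :=
  antitone_nat_of_succ_le (kpow_even_succ_le h h1 h0 htop)

/-! ### Taboo kernels and excursions -/

/-- The taboo kernel of a chain with kernel `K`: `taboo K C n x y` is the probability, started from
`x`, of being at `y` at time `n + 1` with the chain outside `C` at the times `1, …, n`. -/
noncomputable def taboo (K : V → V → ℝ≥0∞) (C : Set V) : ℕ → V → V → ℝ≥0∞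
  | 0 => K
  | n + 1 => fun x y => ∑' z, Cᶜ.indicator (K x) z * taboo K C n z y

lemma taboo_add (K : V → V → ℝ≥0∞) (C : Set V) (m n : ℕ) (x y : V) :
    taboo K C (m + n + 1) x y
      = ∑' z, Cᶜ.indicator (taboo K C m x) z * taboo K C n z y := by
  induction m generalizing x with
  | zero => simp [taboo]
  | succ m ih =>
    have e : ∀ z, Cᶜ.indicator (taboo K C (m + 1) x) z
        = ∑' w, Cᶜ.indicator (K x) w * Cᶜ.indicator (taboo K C m w) z := by
      intro z
      by_cases hz : z ∈ C <;> simp [hz, taboo]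
    simp_rw [e]
    rw [← tsum_tsum_mul_assoc (fun x => Cᶜ.indicator (K x)) (fun w => Cᶜ.indicator (taboo K C m w))
      (fun z => taboo K C n z y) x]
    simp_rw [← ih]
    rw [show m + 1 + n + 1 = (m + n + 1) + 1 by ring, taboo]

lemma taboo_succ' (K : V → V → ℝ≥0∞) (C : Set V) (n : ℕ) (x y : V) :
    taboo K C (n + 1) x y = ∑' z, Cᶜ.indicator (taboo K C n x) z * K z y :=
  taboo_add K C n 0 x y

lemma taboo_symm {K : V → V → ℝ≥0∞} {r : V → ℝ≥0∞} (h : ∀ x y, r x * K x y = r y * K y x)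
    (C : Set V) (n : ℕ) (x y : V) : r x * taboo K C n x y = r y * taboo K C n y x := by
  induction n generalizing x y with
  | zero => exact h x y
  | succ n ih =>
    rw [taboo_succ' K C n y x]
    simp only [taboo, ← ENNReal.tsum_mul_left]
    refine tsum_congr fun z => ?_
    by_cases hz : z ∈ C
    · simp [hz]
    · simp only [Set.mem_compl_iff, hz, not_false_eq_true, Set.indicator_of_mem]
      rw [← mul_assoc, h, mul_right_comm, ih, mul_assoc]

/-- The chain enters `C` at a positive time with probability at most one. -/
lemma tsum_taboo_le_one {K : V → V → ℝ≥0∞} (h1 : ∀ x, ∑' y, K x y ≤ 1) (C : Set V) (x : V) :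
    ∑' n, ∑' y, C.indicator (taboo K C n x) y ≤ 1 := by
  refine ENNReal.tsum_le_of_sum_range_le fun m => ?_
  induction m generalizing x with
  | zero => simp
  | succ m ih =>
    rw [Finset.sum_range_succ']
    have e (n : ℕ) : ∑' y, C.indicator (taboo K C (n + 1) x) y
        = ∑' z, Cᶜ.indicator (K x) z * ∑' y, C.indicator (taboo K C n z) y := by
      simp_rw [← ENNReal.tsum_mul_left]
      rw [ENNReal.tsum_comm]
      refine tsum_congr fun y => ?_
      by_cases hy : y ∈ C <;> simp [hy, taboo]
    simp_rw [e]
    rw [← Summable.tsum_finsetSum fun _ _ => ENNReal.summable]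
    simp_rw [← Finset.mul_sum]
    calc _ ≤ ∑' z, Cᶜ.indicator (K x) z + ∑' y, C.indicator (K x) y := by
          gcongr with z
          · exact mul_le_of_le_one_right' (ih z)
          · rfl
      _ = ∑' z, K x z := by
          rw [← ENNReal.tsum_add]
          refine tsum_congr fun z => ?_
          by_cases hz : z ∈ C <;> simp [hz]
      _ ≤ 1 := h1 x

/-- Decomposition of an `n`-step transition into `C` at the first positive time in `C`. -/
lemma kpow_succ_eq_sum_taboo (K : V → V → ℝ≥0∞) (C : Set V) (n : ℕ) (x : V) {y : V} (hy : y ∈ C) :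
    kpow K (n + 1) x y
      = ∑ a ∈ Finset.range (n + 1), ∑' z, C.indicator (taboo K C a x) z * kpow K (n - a) z y := by
  induction n generalizing x with
  | zero =>
    rw [zero_add, Finset.sum_range_one]
    simp_rw [Nat.sub_zero]
    rw [tsum_mul_kpow_zero, kpow_one]
    simp [hy, taboo]
  | succ n ih =>
    rw [Finset.sum_range_succ']
    have e (a : ℕ) : ∑' z, C.indicator (taboo K C (a + 1) x) z * kpow K (n + 1 - (a + 1)) z y
        = ∑' w, Cᶜ.indicator (K x) w
          * ∑' z, C.indicator (taboo K C a w) z * kpow K (n - a) z y := by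
      rw [tsum_tsum_mul_assoc (fun x => Cᶜ.indicator (K x)) (fun w => C.indicator (taboo K C a w))]
      refine tsum_congr fun z => ?_
      rw [Nat.add_sub_add_right]
      by_cases hz : z ∈ C <;> simp [hz, taboo]
    simp_rw [e]
    rw [← Summable.tsum_finsetSum fun _ _ => ENNReal.summable]
    simp_rw [← Finset.mul_sum, ← ih]
    rw [← ENNReal.tsum_add]
    simp only [kpow, Nat.sub_zero, taboo]
    refine tsum_congr fun z => ?_
    by_cases hz : z ∈ C <;> simp [hz]

end KernelAlgebra

/-! ### Excursions away from a set and renewal -/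

section Excursions

variable {V : Type*}

open Classical in
/-- The probability that the chain with kernel `K`, started from `x ∈ C`, returns to `C` for the
first time at time `n + 1` and does so at `y`; the value is zero unless `x, y ∈ C`. -/
noncomputable def excursion (K : V → V → ℝ≥0∞) (C : Set V) (n : ℕ) (x y : V) : ℝ≥0∞ :=
  if x ∈ C ∧ y ∈ C then taboo K C n x y else 0

/-- The expectation of `w T` over the event that the excursion from `x ∈ C` ends at `y`, where `T`
is the duration of the excursion. -/
noncomputable def excursionMean (K : V → V → ℝ≥0∞) (C : Set V) (w : ℕ → ℝ≥0∞) (x y : V) : ℝ≥0∞ :=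
  ∑' n, w (n + 1) * excursion K C n x y

/-- The kernel of the chain watched only when it is in `C`. -/
noncomputable def induced (K : V → V → ℝ≥0∞) (C : Set V) : V → V → ℝ≥0∞ :=
  excursionMean K C 1

lemma induced_apply (K : V → V → ℝ≥0∞) (C : Set V) (x y : V) :
    induced K C x y = ∑' n, excursion K C n x y := by
  simp [induced, excursionMean]

lemma excursionMean_of_notMem_left {K : V → V → ℝ≥0∞} {C : Set V} {w : ℕ → ℝ≥0∞} {x : V}
    (hx : x ∉ C) (y : V) : excursionMean K C w x y = 0 := by
  simp [excursionMean, excursion, hx]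

lemma excursionMean_of_notMem_right {K : V → V → ℝ≥0∞} {C : Set V} {w : ℕ → ℝ≥0∞} (x : V) {y : V}
    (hy : y ∉ C) : excursionMean K C w x y = 0 := by
  simp [excursionMean, excursion, hy]

lemma excursionMean_symm {K : V → V → ℝ≥0∞} {r : V → ℝ≥0∞} (h : ∀ x y, r x * K x y = r y * K y x)
    (C : Set V) (w : ℕ → ℝ≥0∞) (x y : V) :
    r x * excursionMean K C w x y = r y * excursionMean K C w y x := by
  simp only [excursionMean, ← ENNReal.tsum_mul_left]
  refine tsum_congr fun n => ?_
  rw [mul_left_comm, mul_left_comm (r y)]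
  congr 1
  unfold excursion
  by_cases hx : x ∈ C <;> by_cases hy : y ∈ C <;> simp [hx, hy, taboo_symm h C n x y]

lemma induced_symm {K : V → V → ℝ≥0∞} {r : V → ℝ≥0∞} (h : ∀ x y, r x * K x y = r y * K y x)
    (C : Set V) (x y : V) : r x * induced K C x y = r y * induced K C y x :=
  excursionMean_symm h C 1 x y

lemma tsum_induced_le_one {K : V → V → ℝ≥0∞} (h1 : ∀ x, ∑' y, K x y ≤ 1) (C : Set V) (x : V) :
    ∑' y, induced K C x y ≤ 1 := by
  simp_rw [induced_apply]
  rw [ENNReal.tsum_comm]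
  refine le_trans ?_ (tsum_taboo_le_one h1 C x)
  refine ENNReal.tsum_le_tsum fun n => ENNReal.tsum_le_tsum fun y => ?_
  unfold excursion
  by_cases hx : x ∈ C <;> by_cases hy : y ∈ C <;> simp [hx, hy]

/-- The law of the pair of position and time at the successive visits to `C`, tested against `f` in
the time variable and against the point mass at `o` in the space variable: `visit K C o f l x s`
is `E^x[f (s + T_l); X_{T_l} = o]` with `T_l` the time of the `l`-th return to `C`. -/
noncomputable def visit (K : V → V → ℝ≥0∞) (C : Set V) (o : V) (f : ℕ → ℝ≥0∞) :
    ℕ → V → ℕ → ℝ≥0∞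
  | 0 => fun x s => kpow K 0 x o * f s
  | l + 1 => fun x s => ∑' n, ∑' z, excursion K C n x z * visit K C o f l z (s + n + 1)

lemma tsum_sum_range_eq_tsum_tsum (F : ℕ → ℕ → ℝ≥0∞) :
    ∑' k, ∑ a ∈ Finset.range (k + 1), F a (k - a) = ∑' a, ∑' b, F a b := by
  simp_rw [← Finset.Nat.sum_antidiagonal_eq_sum_range_succ F]
  rw [← ENNReal.tsum_prod, ← Finset.HasAntidiagonal.sigmaAntidiagonalEquivProd.tsum_eq,
    ENNReal.tsum_sigma']
  refine tsum_congr fun n => ?_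
  rw [← Finset.tsum_subtype]
  rfl

/-- Renewal equation: the occupation of `o`, weighted by a function of time, splits at the first
return to `C`. -/
lemma tsum_kpow_mul_eq_add {K : V → V → ℝ≥0∞} {C : Set V} {o x : V} (ho : o ∈ C) (hx : x ∈ C)
    (f : ℕ → ℝ≥0∞) (s : ℕ) :
    ∑' k, kpow K k x o * f (s + k)
      = kpow K 0 x o * f s
        + ∑' n, ∑' z, excursion K C n x z * ∑' k, kpow K k z o * f (s + n + 1 + k) := by
  rw [tsum_eq_zero_add' ENNReal.summable, add_zero]
  congr 1
  have e (k : ℕ) : kpow K (k + 1) x o * f (s + (k + 1))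
      = ∑ a ∈ Finset.range (k + 1),
        ∑' z, excursion K C a x z * (kpow K (k - a) z o * f (s + a + 1 + (k - a))) := by
    rw [kpow_succ_eq_sum_taboo K C k x ho, Finset.sum_mul]
    refine Finset.sum_congr rfl fun a ha => ?_
    have ha' : s + a + 1 + (k - a) = s + (k + 1) := by
      have := Finset.mem_range.1 ha
      omega
    rw [ha', ← ENNReal.tsum_mul_right]
    refine tsum_congr fun z => ?_
    rw [← mul_assoc]
    congr 2
    by_cases hz : z ∈ C <;> simp [hz, hx, excursion]
  simp_rw [e]
  rw [tsum_sum_range_eq_tsum_tsum fun a b =>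
    ∑' z, excursion K C a x z * (kpow K b z o * f (s + a + 1 + b))]
  refine tsum_congr fun a => ?_
  rw [ENNReal.tsum_comm]
  simp_rw [ENNReal.tsum_mul_left]

/-- Renewal decomposition: as every excursion takes at least one unit of time, the occupation of
`o` before time `M` comes from the first `M` returns to `C`. -/
lemma tsum_kpow_mul_eq_sum_visit {K : V → V → ℝ≥0∞} {C : Set V} {o : V} (ho : o ∈ C)
    {f : ℕ → ℝ≥0∞} {M : ℕ} (hf : ∀ t, M ≤ t → f t = 0) (L : ℕ) {x : V} (hx : x ∈ C) {s : ℕ}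
    (hs : M ≤ s + L) :
    ∑' k, kpow K k x o * f (s + k) = ∑ l ∈ Finset.range L, visit K C o f l x s := by
  induction L generalizing x s with
  | zero =>
    simp only [Finset.range_zero, Finset.sum_empty, ENNReal.tsum_eq_zero]
    intro k
    rw [hf _ (by omega), mul_zero]
  | succ L ih =>
    rw [tsum_kpow_mul_eq_add ho hx, Finset.sum_range_succ', add_comm]
    congr 1
    simp only [visit]
    rw [← Summable.tsum_finsetSum fun _ _ => ENNReal.summable]
    refine tsum_congr fun n => ?_
    rw [← Summable.tsum_finsetSum fun _ _ => ENNReal.summable]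
    refine tsum_congr fun z => ?_
    rw [← Finset.mul_sum]
    by_cases hz : z ∈ C
    · rw [ih hz (by omega)]
    · simp [excursion, hz]

lemma visit_le_kpow {K : V → V → ℝ≥0∞} {C : Set V} {o : V} {f : ℕ → ℝ≥0∞} (hf : ∀ t, f t ≤ 1)
    (l : ℕ) (x : V) (s : ℕ) : visit K C o f l x s ≤ kpow (induced K C) l x o := by
  induction l generalizing x s with
  | zero => exact mul_le_of_le_one_right' (hf s)
  | succ l ih =>
    simp only [visit, kpow]
    rw [ENNReal.tsum_comm]
    refine ENNReal.tsum_le_tsum fun z => ?_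
    rw [induced_apply, ← ENNReal.tsum_mul_right]
    exact ENNReal.tsum_le_tsum fun n => mul_le_mul_right (ih _ _) _

/-- The expectation of the sum of `w` over the durations of the first `l` excursions, on the event
that the last of them ends at `o`. -/
noncomputable def excursionSum (K : V → V → ℝ≥0∞) (C : Set V) (w : ℕ → ℝ≥0∞) (o : V) :
    ℕ → V → ℝ≥0∞
  | 0 => 0
  | l + 1 => fun x => ∑' z, induced K C x z * excursionSum K C w o l z
      + ∑' z, excursionMean K C w x z * kpow (induced K C) l z o

/-- The identity on the integers that are at least `k`, and zero below. -/
def truncation (k m : ℕ) : ℝ≥0∞ := if k ≤ m then m else 0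

/-- Markov's inequality for the time of the `l`-th return to `C`. Only the excursions of duration at
least `k` are counted on the right, since the shorter ones contribute at most `l * k` to the total
time. The differences are truncated at zero. -/
lemma sub_mul_visit_le {K : V → V → ℝ≥0∞} {C : Set V} {o : V} {f : ℕ → ℝ≥0∞} (hf : ∀ t, f t ≤ 1)
    {N : ℕ} (hN : ∀ t, t < N → f t = 0) (k l : ℕ) (x : V) (s : ℕ) :
    ((N - s - l * k : ℕ) : ℝ≥0∞) * visit K C o f l x s
      ≤ excursionSum K C (truncation k) o l x := by
  induction l generalizing x s with
  | zero =>
    rcases lt_or_ge s N with hs | hs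
    · simp [visit, hN s hs]
    · simp [Nat.sub_eq_zero_of_le hs]
  | succ l ih =>
    simp only [visit, excursionSum, excursionMean, ← ENNReal.tsum_mul_left]
    rw [ENNReal.tsum_comm, ← ENNReal.tsum_add]
    refine ENNReal.tsum_le_tsum fun z => ?_
    rw [induced_apply, ← ENNReal.tsum_mul_right, ← ENNReal.tsum_mul_right, ← ENNReal.tsum_add]
    refine ENNReal.tsum_le_tsum fun n => ?_
    have h1 : ((N - s - (l + 1) * k : ℕ) : ℝ≥0∞)
        ≤ ((N - (s + n + 1) - l * k : ℕ) : ℝ≥0∞) + truncation k (n + 1) := by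
      unfold truncation
      rw [add_one_mul]
      split_ifs with hk
      · exact_mod_cast (by omega)
      · rw [add_zero]
        exact_mod_cast (by omega)
    calc ((N - s - (l + 1) * k : ℕ) : ℝ≥0∞)
          * (excursion K C n x z * visit K C o f l z (s + n + 1))
        ≤ (((N - (s + n + 1) - l * k : ℕ) : ℝ≥0∞) + truncation k (n + 1))
          * (excursion K C n x z * visit K C o f l z (s + n + 1)) := by gcongr
      _ = excursion K C n x z
            * (((N - (s + n + 1) - l * k : ℕ) : ℝ≥0∞) * visit K C o f l z (s + n + 1))
          + truncation k (n + 1) * excursion K C n x z * visit K C o f l z (s + n + 1) := by ring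
      _ ≤ _ := by
          gcongr
          · exact ih _ _
          · exact visit_le_kpow hf _ _ _

lemma excursionSum_eq (K : V → V → ℝ≥0∞) (C : Set V) (w : ℕ → ℝ≥0∞) (o : V) (l : ℕ) (x : V) :
    excursionSum K C w o l x = ∑ j ∈ Finset.range l, ∑' z, kpow (induced K C) j x z
      * ∑' y, excursionMean K C w z y * kpow (induced K C) (l - 1 - j) y o := by
  induction l generalizing x with
  | zero => simp [excursionSum]
  | succ l ih =>
    rw [Finset.sum_range_succ', tsum_kpow_zero_mul]
    simp only [excursionSum, Nat.add_sub_cancel, Nat.sub_zero]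
    congr 1
    simp_rw [ih, Finset.mul_sum]
    rw [Summable.tsum_finsetSum fun _ _ => ENNReal.summable]
    refine Finset.sum_congr rfl fun j _ => ?_
    rw [tsum_tsum_mul_assoc]
    simp only [kpow]
    rw [show l - (j + 1) = l - 1 - j by omega]

/-- The mean, started from `o`, of `w` of the duration of the excursion that follows the `j`-th
return to `C`. -/
noncomputable def meanDuration (K : V → V → ℝ≥0∞) (C : Set V) (w : ℕ → ℝ≥0∞) (o : V) (j : ℕ) :
    ℝ≥0∞ :=
  ∑' x, kpow (induced K C) j o x * ∑' y, excursionMean K C w x y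

section Bounds

variable {K : V → V → ℝ≥0∞} {r : V → ℝ≥0∞} {C : Set V} {o : V} {a : ℝ≥0∞} {b : ℕ → ℝ≥0∞}

/-- If the heat kernel of the induced chain started from `o` at time `m` is at most `b m`, then
among `j` and `m` the larger can be absorbed in the factor `b`: one sums over the other end of the
chain, after time reversal if needed. -/
lemma tsum_kpow_mul_tsum_le (h : ∀ x y, r x * K x y = r y * K y x) (ha : a ≠ 0) (ha' : a ≠ ∞)
    (hC : ∀ x ∈ C, a ≤ r x) (hb : ∀ m y, kpow (induced K C) m o y ≤ b m) (hb' : Antitone b)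
    (w : ℕ → ℝ≥0∞) {j m i : ℕ} (hi : i ≤ max j m) :
    ∑' x, kpow (induced K C) j o x
        * ∑' y, excursionMean K C w x y * kpow (induced K C) m y o
      ≤ r o / a * b i * (meanDuration K C w o j + meanDuration K C w o m) := by
  have key (x y : V) : x ∈ C → ∀ t t' : ℝ≥0∞, r x * t ≤ r o * t' → t ≤ r o / a * t' := by
    intro hx t t' ht
    rw [← ENNReal.mul_div_right_comm, ENNReal.le_div_iff_mul_le (.inl ha) (.inl ha'), mul_comm]
    exact (mul_le_mul_left (hC x hx) t).trans ht
  rcases le_max_iff.1 hi with hij | him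
  · calc _ ≤ ∑' x, b i * ∑' y, r o / a * (excursionMean K C w y x * kpow (induced K C) m o y) := by
          refine ENNReal.tsum_le_tsum fun x => mul_le_mul' ((hb j x).trans (hb' hij)) ?_
          refine ENNReal.tsum_le_tsum fun y => ?_
          · by_cases hx : x ∈ C
            · refine key x y hx _ _ (le_of_eq ?_)
              rw [← mul_assoc, excursionMean_symm h, mul_assoc, mul_left_comm,
                kpow_symm (induced_symm h C)]
              ring
            · rw [excursionMean_of_notMem_left hx, zero_mul]
              exact zero_le
      _ = r o / a * b i * meanDuration K C w o m := by
          simp_rw [meanDuration, ENNReal.tsum_mul_left]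
          rw [ENNReal.tsum_comm, mul_left_comm, mul_assoc]
          simp_rw [← ENNReal.tsum_mul_left]
          refine tsum_congr fun x => tsum_congr fun y => ?_
          ring
      _ ≤ _ := by
          gcongr
          exact le_add_self
  · calc _ ≤ ∑' x, kpow (induced K C) j o x * ∑' y, excursionMean K C w x y * (r o / a * b i) := by
          refine ENNReal.tsum_le_tsum fun x => mul_le_mul_right ?_ _
          refine ENNReal.tsum_le_tsum fun y => ?_
          by_cases hy : y ∈ C
          · gcongr
            refine key y x hy _ _ ?_
            rw [kpow_symm (induced_symm h C)]
            exact mul_le_mul_right ((hb m y).trans (hb' him)) _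
          · rw [excursionMean_of_notMem_right x hy, zero_mul]
            exact zero_le
      _ = r o / a * b i * meanDuration K C w o j := by
          simp_rw [meanDuration, ENNReal.tsum_mul_right, ← mul_assoc]
          simp only [ENNReal.tsum_mul_right]
          ring
      _ ≤ _ := by
          gcongr
          exact le_self_add

lemma excursionSum_le (h : ∀ x y, r x * K x y = r y * K y x) (ha : a ≠ 0) (ha' : a ≠ ∞)
    (hC : ∀ x ∈ C, a ≤ r x) (hb : ∀ m y, kpow (induced K C) m o y ≤ b m) (hb' : Antitone b)
    (w : ℕ → ℝ≥0∞) (l : ℕ) :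
    excursionSum K C w o l o
      ≤ 2 * (r o / a) * b ((l - 1) / 2) * ∑ j ∈ Finset.range l, meanDuration K C w o j := by
  rw [excursionSum_eq]
  calc _ ≤ ∑ j ∈ Finset.range l, r o / a * b ((l - 1) / 2)
        * (meanDuration K C w o j + meanDuration K C w o (l - 1 - j)) := by
        refine Finset.sum_le_sum fun j hj => tsum_kpow_mul_tsum_le h ha ha' hC hb hb' w ?_
        have := Finset.mem_range.1 hj
        omega
    _ = _ := by
        rw [← Finset.mul_sum, Finset.sum_add_distrib, Finset.sum_range_reflect, ← two_mul]
        ring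

/-- The return probability at the even time `2 N` is bounded by the average over the window
`[N, 2 N]`, hence through the times of the successive returns to `C`. -/
lemma mul_kpow_two_mul_le (h : ∀ x y, r x * K x y = r y * K y x) (h1 : ∀ x, ∑' y, K x y ≤ 1)
    (h0 : r o ≠ 0) (htop : r o ≠ ∞) (ho : o ∈ C) (N : ℕ) :
    (N : ℝ≥0∞) * kpow K (2 * N) o o
      ≤ 2 * ∑ l ∈ Finset.range (2 * N + 1),
          visit K C o (Set.indicator (Set.Icc N (2 * N)) 1) l o 0 := by
  rw [← tsum_kpow_mul_eq_sum_visit (M := 2 * N + 1) ho _ _ ho (by omega)]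
  swap
  · intro t ht
    exact Set.indicator_of_notMem (fun h => by have := h.2; omega) _
  simp_rw [zero_add]
  have hinj : Set.InjOn (fun m : ℕ => 2 * m) (Finset.Icc (N - N / 2) N : Finset ℕ) :=
    fun x _ y _ hxy => by simpa using hxy
  calc (N : ℝ≥0∞) * kpow K (2 * N) o o
      ≤ 2 * ∑ m ∈ Finset.Icc (N - N / 2) N, kpow K (2 * N) o o := by
        rw [Finset.sum_const, nsmul_eq_mul, ← mul_assoc, Nat.card_Icc]
        gcongr
        exact_mod_cast (by omega)
    _ ≤ 2 * ∑ m ∈ Finset.Icc (N - N / 2) N,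
          kpow K (2 * m) o o * (Set.Icc N (2 * N)).indicator 1 (2 * m) := by
        gcongr with m hm
        rw [Finset.mem_Icc] at hm
        rw [Set.indicator_of_mem (Set.mem_Icc.2 ⟨by omega, by omega⟩), Pi.one_apply, mul_one]
        exact kpow_even_antitone h h1 h0 htop hm.2
    _ = 2 * ∑ k ∈ (Finset.Icc (N - N / 2) N).image (fun m => 2 * m),
          kpow K k o o * (Set.Icc N (2 * N)).indicator 1 k := by
        rw [Finset.sum_image hinj]
    _ ≤ _ := by
        gcongr
        exact ENNReal.sum_le_tsum _

end Bounds

end Excursions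

/-! ### The maximal ergodic inequality -/

section MaximalErgodic

variable {Ω : Type*}

lemma addMonoidHom_mono (Q : (Ω → ℝ≥0∞) →+ (Ω → ℝ≥0∞)) : Monotone Q := by
  intro f g hfg
  rw [← add_tsub_cancel_of_le hfg, map_add]
  exact le_self_add

/-- The functions `h` with `h 0 = 0` and `h (n + 1) = (f + Q (h n) - lam)⁺`, which dominate the
positive parts of `S m f - m * lam`, `m ≤ n`, where `S m f` is the sum of the first `m` iterates
of `Q` at `f`. -/
noncomputable def excess (Q : (Ω → ℝ≥0∞) →+ (Ω → ℝ≥0∞)) (f : Ω → ℝ≥0∞) (lam : ℝ≥0∞) :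
    ℕ → Ω → ℝ≥0∞
  | 0 => 0
  | n + 1 => fun x => f x + Q (excess Q f lam n) x - lam

lemma excess_mono (Q : (Ω → ℝ≥0∞) →+ (Ω → ℝ≥0∞)) (f : Ω → ℝ≥0∞) (lam : ℝ≥0∞) :
    Monotone (excess Q f lam) := by
  refine monotone_nat_of_le_succ fun n => ?_
  induction n with
  | zero => exact fun _ => zero_le
  | succ n ih => exact fun x => tsub_le_tsub_right (add_le_add_right (addMonoidHom_mono Q ih x) _) _

lemma sum_iterate_succ (Q : (Ω → ℝ≥0∞) →+ (Ω → ℝ≥0∞)) (f : Ω → ℝ≥0∞) (n : ℕ) :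
    ∑ j ∈ Finset.range (n + 1), Q^[j] f = f + Q (∑ j ∈ Finset.range n, Q^[j] f) := by
  rw [Finset.sum_range_succ', map_sum, add_comm]
  simp_rw [Function.iterate_succ_apply']
  rfl

lemma sum_iterate_le_excess {Q : (Ω → ℝ≥0∞) →+ (Ω → ℝ≥0∞)}
    (hQ : ∀ c : ℝ≥0∞, Q (fun _ => c) ≤ fun _ => c) (f : Ω → ℝ≥0∞) (lam : ℝ≥0∞) (n : ℕ) (x : Ω) :
    (∑ j ∈ Finset.range n, Q^[j] f) x ≤ excess Q f lam n x + n * lam := by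
  induction n generalizing x with
  | zero => simp
  | succ n ih =>
    rw [sum_iterate_succ]
    have h1 : Q (∑ j ∈ Finset.range n, Q^[j] f)
        ≤ Q (excess Q f lam n) + fun _ => (n : ℝ≥0∞) * lam := by
      refine (addMonoidHom_mono Q (b := excess Q f lam n + fun _ => (n : ℝ≥0∞) * lam) ih).trans ?_
      rw [map_add]
      exact add_le_add_right (hQ _) _
    calc f x + Q (∑ j ∈ Finset.range n, Q^[j] f) x
        ≤ f x + (Q (excess Q f lam n) x + n * lam) := add_le_add_right (h1 x) _
      _ ≤ (excess Q f lam (n + 1) x + lam) + n * lam := by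
          rw [← add_assoc]
          exact add_le_add_left le_tsub_add _
      _ = _ := by push_cast; ring

variable [MeasurableSpace Ω] {m : Measure Ω}

/-- **Maximal ergodic inequality** (Hopf) for a positive operator `Q` that is sub-Markov and
contracts the integral. With `h n` the functions of `excess`, integrating `h (n + 1) + lam ≤ f + Q
(h n)` over `{h (n + 1) > 0}` and using `∫ Q (h n) ≤ ∫ h n ≤ ∫ h (n + 1)` gives `lam * m {h (n +
1) > 0} ≤ ∫ f`. -/
theorem mul_measure_exists_lt_sum_iterate_le {Q : (Ω → ℝ≥0∞) →+ (Ω → ℝ≥0∞)}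
    (hQ : ∀ c : ℝ≥0∞, Q (fun _ => c) ≤ fun _ => c)
    (hmeas : ∀ f, Measurable f → Measurable (Q f))
    (hint : ∀ f, Measurable f → ∫⁻ x, Q f x ∂m ≤ ∫⁻ x, f x ∂m) {f : Ω → ℝ≥0∞} (hf : Measurable f)
    (hfin : ∫⁻ x, f x ∂m ≠ ∞) (lam : ℝ≥0∞) :
    lam * m {x | ∃ n : ℕ, n * lam < (∑ j ∈ Finset.range n, Q^[j] f) x} ≤ ∫⁻ x, f x ∂m := by
  set h := excess Q f lam
  have hm (n : ℕ) : Measurable (h n) := by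
    induction n with
    | zero => exact measurable_zero
    | succ n ih => exact (hf.add (hmeas _ ih)).sub_const lam
  have hmono : Monotone h := excess_mono Q f lam
  have hfinite (n : ℕ) : ∫⁻ x, h n x ∂m ≠ ∞ := by
    induction n with
    | zero => simp [h, excess]
    | succ n ih =>
      refine ne_top_of_le_ne_top (ENNReal.add_ne_top.2 ⟨hfin, ih⟩) ?_
      calc ∫⁻ x, h (n + 1) x ∂m ≤ ∫⁻ x, (f x + Q (h n) x) ∂m :=
            lintegral_mono fun x => tsub_le_self
        _ = ∫⁻ x, f x ∂m + ∫⁻ x, Q (h n) x ∂m := lintegral_add_left hf _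
        _ ≤ _ := add_le_add_right (hint _ (hm n)) _
  have hE (n : ℕ) : MeasurableSet {x | 0 < h n x} := measurableSet_lt measurable_const (hm n)
  have step (n : ℕ) : lam * m {x | 0 < h n x} ≤ ∫⁻ x, f x ∂m := by
    rcases n with _ | n
    · simp [h, excess]
    · set E := {x | 0 < h (n + 1) x}
      have h1 : ∫⁻ x, h (n + 1) x ∂m + lam * m E ≤ ∫⁻ x, h (n + 1) x ∂m + ∫⁻ x, f x ∂m := by
        calc ∫⁻ x, h (n + 1) x ∂m + lam * m E
            = ∫⁻ x, (h (n + 1) x + E.indicator (fun _ => lam) x) ∂m := by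
              rw [lintegral_add_left (hm _), lintegral_indicator_const (hE _)]
          _ ≤ ∫⁻ x, (f x + Q (h n) x) ∂m := by
              refine lintegral_mono fun x => ?_
              by_cases hx : x ∈ E
              · rw [Set.indicator_of_mem hx]
                have : 0 < f x + Q (h n) x - lam := hx
                exact (tsub_add_cancel_of_le (tsub_pos_iff_lt.1 this).le).le
              · rw [Set.indicator_of_notMem hx, add_zero]
                exact tsub_le_self
          _ = ∫⁻ x, f x ∂m + ∫⁻ x, Q (h n) x ∂m := lintegral_add_left hf _
          _ ≤ ∫⁻ x, f x ∂m + ∫⁻ x, h (n + 1) x ∂m := by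
              refine add_le_add_right ((hint _ (hm n)).trans ?_) _
              exact lintegral_mono (hmono n.le_succ)
          _ = _ := add_comm _ _
      exact (ENNReal.add_le_add_iff_left (hfinite (n + 1))).1 h1
  have hU : {x | ∃ n : ℕ, n * lam < (∑ j ∈ Finset.range n, Q^[j] f) x} ⊆ ⋃ n, {x | 0 < h n x} := by
    rintro x ⟨n, hn⟩
    refine Set.mem_iUnion.2 ⟨n, show 0 < h n x from pos_iff_ne_zero.2 fun h0 => ?_⟩
    have h2 := sum_iterate_le_excess hQ f lam n x
    change _ ≤ h n x + _ at h2
    rw [h0, zero_add] at h2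
    exact hn.not_ge h2
  have hEmono : Monotone fun n => {x | 0 < h n x} :=
    fun i j hij x hx => lt_of_lt_of_le hx (hmono hij x)
  calc _ ≤ lam * m (⋃ n, {x | 0 < h n x}) := by gcongr
    _ = ⨆ n, lam * m {x | 0 < h n x} := by rw [hEmono.measure_iUnion, ENNReal.mul_iSup]
    _ ≤ _ := iSup_le step

/-- If the functions `u k` decrease to zero in mean, then almost surely all their ergodic averages
are uniformly small once `k` is large. -/
lemma ae_exists_forall_sum_iterate_le {Q : (Ω → ℝ≥0∞) →+ (Ω → ℝ≥0∞)}
    (hQ : ∀ c : ℝ≥0∞, Q (fun _ => c) ≤ fun _ => c)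
    (hmeas : ∀ f, Measurable f → Measurable (Q f))
    (hint : ∀ f, Measurable f → ∫⁻ x, Q f x ∂m ≤ ∫⁻ x, f x ∂m) {u : ℕ → Ω → ℝ≥0∞}
    (hu : ∀ k, Measurable (u k)) (h0 : Tendsto (fun k => ∫⁻ x, u k x ∂m) atTop (𝓝 0)) :
    ∀ᵐ x ∂m, ∀ e : ℝ≥0∞, e ≠ 0 →
      ∃ k, ∀ n : ℕ, (∑ j ∈ Finset.range n, Q^[j] (u k)) x ≤ n * e := by
  have h1 (e : ℝ≥0∞) (he : e ≠ 0) :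
      ∀ᵐ x ∂m, ∃ k, ∀ n : ℕ, (∑ j ∈ Finset.range n, Q^[j] (u k)) x ≤ n * e := by
    rw [ae_iff]
    push Not
    set B := {x | ∀ k, ∃ n : ℕ, n * e < (∑ j ∈ Finset.range n, Q^[j] (u k)) x}
    have hB : ∀ᶠ k in atTop, e * m B ≤ ∫⁻ x, u k x ∂m := by
      filter_upwards [h0.eventually (gt_mem_nhds ENNReal.zero_lt_top)] with k hk
      refine le_trans ?_ (mul_measure_exists_lt_sum_iterate_le hQ hmeas hint (hu k) hk.ne e)
      gcongr
      exact fun x hx => hx k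
    have := ge_of_tendsto h0 hB
    simpa [he] using this
  have h2 : ∀ᵐ x ∂m, ∀ i : ℕ,
      ∃ k, ∀ n : ℕ, (∑ j ∈ Finset.range n, Q^[j] (u k)) x ≤ n * (i : ℝ≥0∞)⁻¹ :=
    ae_all_iff.2 fun i => h1 _ (by simp)
  filter_upwards [h2] with x hx e he
  obtain ⟨i, hi⟩ := ENNReal.exists_inv_nat_lt he
  obtain ⟨k, hk⟩ := hx i
  exact ⟨k, fun n => (hk n).trans (by gcongr)⟩

end MaximalErgodic

/-! ### Covariance under relabelling -/

section Covariance

variable {V : Type*} (K : V → V → ℝ≥0∞) (C : Set V) (e : V ≃ V)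

lemma kpow_comp_equiv (n : ℕ) (x y : V) :
    kpow (fun x y => K (e x) (e y)) n x y = kpow K n (e x) (e y) := by
  induction n generalizing x with
  | zero => by_cases h : x = y <;> simp [kpow, h]
  | succ n ih =>
    simp only [kpow, ih]
    exact e.tsum_eq fun z => K (e x) z * kpow K n z (e y)

lemma taboo_comp_equiv (n : ℕ) (x y : V) :
    taboo (fun x y => K (e x) (e y)) (e ⁻¹' C) n x y = taboo K C n (e x) (e y) := by
  induction n generalizing x with
  | zero => rfl
  | succ n ih =>
    simp only [taboo, ih]
    exact e.tsum_eq fun z => Cᶜ.indicator (K (e x)) z * taboo K C n z (e y)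

lemma excursionMean_comp_equiv (w : ℕ → ℝ≥0∞) (x y : V) :
    excursionMean (fun x y => K (e x) (e y)) (e ⁻¹' C) w x y = excursionMean K C w (e x) (e y) := by
  simp only [excursionMean, excursion, taboo_comp_equiv]
  rfl

end Covariance

/-! ### Reversibility and shifts of the environment -/

section Environment

variable {d : ℕ}

/-- The transition kernel of the walk, with values in `[0, ∞]`. -/
noncomputable def walkKernel (ω : Env d) (x y : Fin d → ℤ) : ℝ≥0∞ :=
  ENNReal.ofReal (transProb ω x y)

/-- The reversing weight `π_ω`, with values in `[0, ∞]`. -/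
noncomputable def weight (ω : Env d) (x : Fin d → ℤ) : ℝ≥0∞ :=
  ENNReal.ofReal (totalConductance ω x)

lemma conductance_comm (ω : Env d) (x y : Fin d → ℤ) : conductance ω x y = conductance ω y x := by
  unfold conductance
  by_cases h : (lattice d).Adj x y
  · rw [dif_pos h, dif_pos h.symm]
    congr 2
    exact Subtype.ext Sym2.eq_swap
  · rw [dif_neg h, dif_neg fun h' => h h'.symm]

lemma conductance_le_one (ω : Env d) (x y : Fin d → ℤ) : conductance ω x y ≤ 1 := by
  unfold conductance
  split_ifs
  · exact (ω _).2.2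
  · exact zero_le_one

lemma weight_eq_tsum (ω : Env d) (x : Fin d → ℤ) :
    weight ω x = ∑' y, ENNReal.ofReal (conductance ω x y) :=
  ENNReal.ofReal_tsum_of_nonneg (conductance_nonneg ω x) (summable_conductance ω x)

lemma weight_ne_top (ω : Env d) (x : Fin d → ℤ) : weight ω x ≠ ∞ := ENNReal.ofReal_ne_top

lemma weight_ne_zero [NeZero d] (ω : Env d) (x : Fin d → ℤ) : weight ω x ≠ 0 :=
  (ENNReal.ofReal_pos.2 (totalConductance_pos ω x)).ne'

lemma weight_mul_walkKernel [NeZero d] (ω : Env d) (x y : Fin d → ℤ) :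
    weight ω x * walkKernel ω x y = ENNReal.ofReal (conductance ω x y) := by
  have h := totalConductance_pos ω x
  rw [weight, walkKernel, ← ENNReal.ofReal_mul h.le, transProb, mul_div_cancel₀ _ h.ne']

lemma walkKernel_symm [NeZero d] (ω : Env d) (x y : Fin d → ℤ) :
    weight ω x * walkKernel ω x y = weight ω y * walkKernel ω y x := by
  rw [weight_mul_walkKernel, weight_mul_walkKernel, conductance_comm]

lemma tsum_walkKernel [NeZero d] (ω : Env d) (x : Fin d → ℤ) : ∑' y, walkKernel ω x y = 1 := by
  have h := weight_mul_walkKernel ω x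
  have h2 : weight ω x * ∑' y, walkKernel ω x y = weight ω x * 1 := by
    rw [← ENNReal.tsum_mul_left, mul_one, tsum_congr h, weight_eq_tsum]
  exact (ENNReal.mul_right_inj (weight_ne_zero ω x) (weight_ne_top ω x)).1 h2

lemma exists_weight_le (x : Fin d → ℤ) : ∃ B : ℝ≥0∞, B ≠ ∞ ∧ ∀ ω : Env d, weight ω x ≤ B := by
  refine ⟨∑ _y ∈ (neighborSet_finite x).toFinset, 1, by simp, fun ω => ?_⟩
  rw [weight_eq_tsum, tsum_eq_sum (s := (neighborSet_finite x).toFinset)]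
  · exact Finset.sum_le_sum fun y _ => ENNReal.ofReal_le_one.2 (conductance_le_one ω x y)
  · intro y hy
    rw [Set.Finite.mem_toFinset, SimpleGraph.mem_neighborSet] at hy
    rw [conductance, dif_neg hy, ENNReal.ofReal_zero]

lemma le_weight_of_mem_strongComponent {ω : Env d} {α : ℝ} {x : Fin d → ℤ}
    (hx : x ∈ strongComponent ω α) : ENNReal.ofReal α ≤ weight ω x := by
  obtain ⟨γ, -, ⟨k, rfl⟩, hγ⟩ := hx
  obtain ⟨h, hα⟩ := hγ k
  rw [weight_eq_tsum]
  refine le_trans ?_ (ENNReal.le_tsum (γ (k + 1)))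
  rw [conductance, dif_pos h]
  exact ENNReal.ofReal_le_ofReal hα

lemma adj_add_right_iff (x y z : Fin d → ℤ) :
    (lattice d).Adj (x + z) (y + z) ↔ (lattice d).Adj x y := by
  simp [lattice]

lemma shift_apply (ω : Env d) (z x y : Fin d → ℤ) (h : (lattice d).Adj x y) :
    shift z ω ⟨s(x, y), h⟩ = ω ⟨s(x + z, y + z), (adj_add_right_iff x y z).2 h⟩ := rfl

lemma shift_shift (ω : Env d) (x z : Fin d → ℤ) : shift x (shift z ω) = shift (x + z) ω := by
  funext ⟨e, he⟩
  induction e with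
  | _ a b =>
    rw [shift_apply _ _ _ _ he, shift_apply, shift_apply _ _ _ _ he]
    congr 3 <;> rw [add_assoc]

lemma shift_zero (ω : Env d) : shift 0 ω = ω := by
  funext ⟨e, he⟩
  induction e with
  | _ a b =>
    rw [shift_apply _ _ _ _ he]
    congr 3 <;> rw [add_zero]

lemma conductance_shift (ω : Env d) (z x y : Fin d → ℤ) :
    conductance (shift z ω) x y = conductance ω (x + z) (y + z) := by
  unfold conductance
  by_cases h : (lattice d).Adj x y
  · rw [dif_pos h, dif_pos ((adj_add_right_iff x y z).2 h), shift_apply]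
  · rw [dif_neg h, dif_neg (mt (adj_add_right_iff x y z).1 h)]

lemma totalConductance_shift (ω : Env d) (z x : Fin d → ℤ) :
    totalConductance (shift z ω) x = totalConductance ω (x + z) := by
  unfold totalConductance
  simp_rw [conductance_shift]
  exact (Equiv.addRight z).tsum_eq fun y => conductance ω (x + z) y

lemma weight_shift (ω : Env d) (z x : Fin d → ℤ) : weight (shift z ω) x = weight ω (x + z) := by
  rw [weight, weight, totalConductance_shift]

lemma walkKernel_shift (ω : Env d) (z : Fin d → ℤ) :
    walkKernel (shift z ω) = fun x y => walkKernel ω (Equiv.addRight z x) (Equiv.addRight z y) := by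
  funext x y
  simp [walkKernel, transProb, conductance_shift, totalConductance_shift]

lemma strongComponent_shift_subset (ω : Env d) (α : ℝ) (z : Fin d → ℤ) {x : Fin d → ℤ}
    (hx : x ∈ strongComponent (shift z ω) α) : x + z ∈ strongComponent ω α := by
  obtain ⟨γ, hinj, ⟨k, rfl⟩, hγ⟩ := hx
  refine ⟨fun n => γ n + z, fun i j hij => hinj (add_right_cancel hij), ⟨k, rfl⟩, fun n => ?_⟩
  obtain ⟨h, hα⟩ := hγ n
  exact ⟨(adj_add_right_iff _ _ z).2 h, hα⟩

lemma strongComponent_shift (ω : Env d) (α : ℝ) (z : Fin d → ℤ) :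
    strongComponent (shift z ω) α = Equiv.addRight z ⁻¹' strongComponent ω α := by
  ext x
  refine ⟨strongComponent_shift_subset ω α z, fun hx => ?_⟩
  have h0 : shift (-z) (shift z ω) = ω := by
    rw [shift_shift, neg_add_cancel, shift_zero]
  have := strongComponent_shift_subset (shift z ω) α (-z) (x := x + z) (by rw [h0]; exact hx)
  rwa [add_neg_cancel_right] at this

lemma strongComponent_anti (ω : Env d) {α β : ℝ} (h : α ≤ β) :
    strongComponent ω β ⊆ strongComponent ω α := by
  rintro x ⟨γ, hinj, hx, hγ⟩
  exact ⟨γ, hinj, hx, fun k => let ⟨h', hα⟩ := hγ k; ⟨h', h.trans hα⟩⟩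

/-! ### Measurability -/

lemma continuous_conductance (x y : Fin d → ℤ) : Continuous fun ω : Env d => conductance ω x y := by
  unfold conductance
  split_ifs with h
  · exact continuous_subtype_val.comp (continuous_apply _)
  · exact continuous_const

lemma measurable_conductance (x y : Fin d → ℤ) : Measurable fun ω : Env d => conductance ω x y :=
  (continuous_conductance x y).measurable

lemma measurable_weight (x : Fin d → ℤ) : Measurable fun ω : Env d => weight ω x := by
  simp_rw [weight_eq_tsum]
  exact Measurable.tsum fun y => (measurable_conductance x y).ennreal_ofReal

lemma measurable_walkKernel [NeZero d] (x y : Fin d → ℤ) :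
    Measurable fun ω : Env d => walkKernel ω x y := by
  have h (ω : Env d) : walkKernel ω x y = ENNReal.ofReal (conductance ω x y) / weight ω x := by
    rw [← weight_mul_walkKernel, mul_comm,
      ENNReal.mul_div_cancel_right (weight_ne_zero ω x) (weight_ne_top ω x)]
  simp_rw [h]
  exact (measurable_conductance x y).ennreal_ofReal.div (measurable_weight x)

/-- A vertex of the strong component starts an infinite self-avoiding path of strong edges. As the
path moves at unit speed, it lives in a product of finite sets. -/
lemma mem_strongComponent_iff {ω : Env d} {α : ℝ} (hα : 0 < α) (x : Fin d → ℤ) :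
    x ∈ strongComponent ω α ↔ ∃ γ : Set.univ.pi fun n : ℕ => {y : Fin d → ℤ | ∀ i, |y i - x i| ≤ n},
      Function.Injective γ.1 ∧ γ.1 0 = x ∧ ∀ k, α ≤ conductance ω (γ.1 k) (γ.1 (k + 1)) := by
  constructor
  · rintro ⟨γ, hinj, ⟨m, rfl⟩, hγ⟩
    refine ⟨⟨fun n => γ (n + m), fun n hn i => ?_⟩, fun i j hij => by simpa using hinj hij,
      by simp, fun k => ?_⟩
    · change |γ (n + m) i - γ m i| ≤ n
      clear hn
      induction n with
      | zero => simp
      | succ n ih =>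
        obtain ⟨h, -⟩ := hγ (n + m)
        have h1 : ∑ i, |γ (n + m) i - γ (n + m + 1) i| = 1 := h
        have h2 : |γ (n + m) i - γ (n + m + 1) i| ≤ 1 := by
          rw [← h1]
          exact Finset.single_le_sum (f := fun i => |γ (n + m) i - γ (n + m + 1) i|)
            (fun _ _ => abs_nonneg _) (Finset.mem_univ i)
        rw [show n + 1 + m = n + m + 1 by ring]
        rw [abs_le] at h2 ih ⊢
        push_cast
        constructor <;> linarith [h2.1, h2.2, ih.1, ih.2]
    · obtain ⟨h, hk⟩ := hγ (k + m)
      change α ≤ conductance ω (γ (k + m)) (γ (k + 1 + m))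
      rw [show k + 1 + m = k + m + 1 by ring, conductance, dif_pos h]
      exact hk
  · rintro ⟨γ, hinj, h0, hγ⟩
    refine ⟨γ.1, hinj, ⟨0, h0⟩, fun k => ?_⟩
    have h1 := hγ k
    by_cases h : (lattice d).Adj (γ.1 k) (γ.1 (k + 1))
    · rw [conductance, dif_pos h] at h1
      exact ⟨h, h1⟩
    · rw [conductance, dif_neg h] at h1
      exact absurd h1 hα.not_ge

/-- The event that `x` is in the strong component is closed, being the projection of a closed set
along a compact space of paths. -/
lemma isClosed_mem_strongComponent {α : ℝ} (hα : 0 < α) (x : Fin d → ℤ) :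
    IsClosed {ω : Env d | x ∈ strongComponent ω α} := by
  set S : Set (ℕ → Fin d → ℤ) := Set.univ.pi fun n : ℕ => {y : Fin d → ℤ | ∀ i, |y i - x i| ≤ n}
  have hfin (n : ℕ) : {y : Fin d → ℤ | ∀ i, |y i - x i| ≤ n}.Finite := by
    refine (Set.Finite.pi' (t := fun i => Set.Icc (x i - n) (x i + n))
      fun i => Set.finite_Icc _ _).subset fun y hy i => ?_
    have := abs_le.1 (hy i)
    exact ⟨by linarith, by linarith⟩
  have : CompactSpace S :=
    isCompact_iff_compactSpace.1 (isCompact_univ_pi fun n => (hfin n).isCompact)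
  have hev (k : ℕ) : Continuous fun p : S × Env d => p.1.1 k :=
    (continuous_apply k).comp (continuous_subtype_val.comp continuous_fst)
  have hcond (k : ℕ) :
      Continuous fun p : S × Env d => conductance p.2 (p.1.1 k) (p.1.1 (k + 1)) := by
    have h1 : Continuous fun q : ((Fin d → ℤ) × (Fin d → ℤ)) × Env d =>
        conductance q.2 q.1.1 q.1.2 :=
      continuous_prod_of_discrete_left.2 fun a => continuous_conductance a.1 a.2
    exact h1.comp (((hev k).prodMk (hev (k + 1))).prodMk continuous_snd)
  have hA : IsClosed {p : S × Env d | Function.Injective p.1.1 ∧ p.1.1 0 = x ∧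
      ∀ k, α ≤ conductance p.2 (p.1.1 k) (p.1.1 (k + 1))} := by
    have e : {p : S × Env d | Function.Injective p.1.1 ∧ p.1.1 0 = x ∧
        ∀ k, α ≤ conductance p.2 (p.1.1 k) (p.1.1 (k + 1))}
        = (⋂ (i : ℕ) (j : ℕ) (_ : i ≠ j), {p : S × Env d | p.1.1 i ≠ p.1.1 j})
          ∩ ({p | p.1.1 0 = x} ∩ ⋂ k, {p | α ≤ conductance p.2 (p.1.1 k) (p.1.1 (k + 1))}) := by
      ext p
      simp only [Set.mem_ofPred_eq, Set.mem_inter_iff, Set.mem_iInter]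
      refine and_congr_left' ⟨fun h i j hij h' => hij (h h'), fun h i j hij => ?_⟩
      by_contra hne
      exact h i j hne hij
    rw [e]
    refine IsClosed.inter
      (isClosed_iInter fun i => isClosed_iInter fun j => isClosed_iInter fun _ => ?_)
      ((isClosed_eq (hev 0) continuous_const).inter
        (isClosed_iInter fun k => isClosed_le continuous_const (hcond k)))
    exact (isClosed_discrete {q : (Fin d → ℤ) × (Fin d → ℤ) | q.1 ≠ q.2}).preimage
      ((hev i).prodMk (hev j))
  convert! isClosedMap_snd_of_compactSpace _ hA using 1
  ext ω
  rw [Set.mem_ofPred_eq, mem_strongComponent_iff hα]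
  simp only [Set.mem_image, Set.mem_ofPred_eq, Prod.exists, exists_eq_right]
  rfl

lemma measurableSet_mem_strongComponent {α : ℝ} (hα : 0 < α) (x : Fin d → ℤ) :
    MeasurableSet {ω : Env d | x ∈ strongComponent ω α} :=
  (isClosed_mem_strongComponent hα x).measurableSet

lemma measurable_taboo [NeZero d] {α : ℝ} (hα : 0 < α) (n : ℕ) (x y : Fin d → ℤ) :
    Measurable fun ω : Env d => taboo (walkKernel ω) (strongComponent ω α) n x y := by
  induction n generalizing x with
  | zero => exact measurable_walkKernel x y
  | succ n ih =>
    refine Measurable.tsum fun z => Measurable.mul ?_ (ih z)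
    exact (measurable_walkKernel x z).indicator (measurableSet_mem_strongComponent hα z).compl

lemma measurable_excursionMean [NeZero d] {α : ℝ} (hα : 0 < α) (w : ℕ → ℝ≥0∞) (x y : Fin d → ℤ) :
    Measurable fun ω : Env d => excursionMean (walkKernel ω) (strongComponent ω α) w x y := by
  refine Measurable.tsum fun n => Measurable.const_mul ?_ _
  exact Measurable.ite ((measurableSet_mem_strongComponent hα x).inter
    (measurableSet_mem_strongComponent hα y)) (measurable_taboo hα n x y) measurable_const

end Environment

/-! ### Duration of excursions -/

section Kac

variable {V : Type*}

lemma tsum_eq_tsum_add_of_eq_zero {f : ℕ → ℝ≥0∞} {m : ℕ} (h : ∀ i < m, f i = 0) :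
    ∑' n, f n = ∑' n, f (n + m) := by
  rw [← ENNReal.summable.sum_add_tsum_nat_add' (k := m),
    Finset.sum_eq_zero fun i hi => h i (Finset.mem_range.1 hi), zero_add]

lemma tsum_nat_mul_eq (e : ℕ → ℝ≥0∞) :
    ∑' n : ℕ, (n : ℝ≥0∞) * e n = ∑' n, ∑' k, e (k + n + 1) := by
  have h (n : ℕ) : ∑' k, e (k + n + 1) = ∑' k, if n < k then e k else 0 := by
    rw [tsum_eq_tsum_add_of_eq_zero (m := n + 1) fun i hi => if_neg (by omega)]
    refine tsum_congr fun k => ?_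
    rw [if_pos (by omega), add_assoc]
  simp_rw [h]
  rw [ENNReal.tsum_comm]
  refine tsum_congr fun k => ?_
  rw [tsum_eq_sum (s := Finset.range k) fun n hn => if_neg (by simpa using hn),
    Finset.sum_congr rfl fun n hn => if_pos (Finset.mem_range.1 hn)]
  simp

/-- The mean duration of an excursion from `x` is at most one plus the sum over `n` and `z` of the
probability of being at `z` at time `n + 1` without having visited `C` at a positive time. -/
lemma tsum_excursionMean_natCast_le {K : V → V → ℝ≥0∞} (h1 : ∀ x, ∑' y, K x y ≤ 1) (C : Set V)
    (x : V) : ∑' y, excursionMean K C (fun n => n) x y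
      ≤ 1 + ∑' n, ∑' z, Cᶜ.indicator (taboo K C n x) z := by
  classical
  set e : ℕ → ℝ≥0∞ := fun n => ∑' y, C.indicator (taboo K C n x) y
  have h (n : ℕ) : ∑' k, e (k + n + 1) ≤ ∑' z, Cᶜ.indicator (taboo K C n x) z := by
    have h2 (k : ℕ) : e (k + n + 1)
        = ∑' z, Cᶜ.indicator (taboo K C n x) z * ∑' y, C.indicator (taboo K C k z) y := by
      simp_rw [← ENNReal.tsum_mul_left]
      rw [ENNReal.tsum_comm]
      refine tsum_congr fun y => ?_
      rw [add_comm k n, Set.indicator_apply, taboo_add]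
      by_cases hy : y ∈ C <;> simp [hy]
    simp_rw [h2]
    rw [ENNReal.tsum_comm]
    simp_rw [ENNReal.tsum_mul_left]
    exact ENNReal.tsum_le_tsum fun z => mul_le_of_le_one_right' (tsum_taboo_le_one h1 C z)
  calc _ ≤ ∑' n, ((n + 1 : ℕ) : ℝ≥0∞) * e n := by
        simp_rw [excursionMean]
        rw [ENNReal.tsum_comm]
        simp_rw [ENNReal.tsum_mul_left]
        refine ENNReal.tsum_le_tsum fun n => mul_le_mul_right (ENNReal.tsum_le_tsum fun y => ?_) _
        unfold excursion
        by_cases hx : x ∈ C <;> by_cases hy : y ∈ C <;> simp [hx, hy]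
    _ = ∑' n, e n + ∑' n : ℕ, (n : ℝ≥0∞) * e n := by
        rw [← ENNReal.tsum_add]
        refine tsum_congr fun n => ?_
        push_cast
        ring
    _ ≤ _ := by
        rw [tsum_nat_mul_eq]
        exact add_le_add (tsum_taboo_le_one h1 C x) (ENNReal.tsum_le_tsum h)

end Kac

/-! ### The environment seen from the coarse-grained walk -/

section EnvironmentChain

variable {d : ℕ} {P : Measure (Env d)}

/-- **Mass transport**: under a shift-invariant law the mean mass sent out from the origin equals
the mean mass received at the origin. -/
lemma lintegral_tsum_eq_lintegral_tsum (hP : ∀ x : Fin d → ℤ, MeasurePreserving (shift x) P P)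
    {F : Env d → (Fin d → ℤ) → (Fin d → ℤ) → ℝ≥0∞} (hF : ∀ x y, Measurable fun ω => F ω x y)
    (hcov : ∀ ω x y z, F (shift z ω) x y = F ω (x + z) (y + z)) :
    ∫⁻ ω, ∑' z, F ω 0 z ∂P = ∫⁻ ω, ∑' z, F ω z 0 ∂P := by
  rw [lintegral_tsum fun z => (hF 0 z).aemeasurable, lintegral_tsum fun z => (hF z 0).aemeasurable,
    ← (Equiv.neg (Fin d → ℤ)).tsum_eq]
  refine tsum_congr fun z => ?_
  rw [← (hP z).lintegral_comp (hF 0 _)]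
  simp [hcov]

variable {α : ℝ}

lemma indicator_compl_taboo_shift (ω : Env d) (α : ℝ) (n : ℕ) (x y z : Fin d → ℤ) :
    (strongComponent (shift z ω) α)ᶜ.indicator
        (taboo (walkKernel (shift z ω)) (strongComponent (shift z ω) α) n x) y
      = (strongComponent ω α)ᶜ.indicator
        (taboo (walkKernel ω) (strongComponent ω α) n (x + z)) (y + z) := by
  classical
  rw [walkKernel_shift, strongComponent_shift, Set.indicator_apply, Set.indicator_apply,
    taboo_comp_equiv]
  rfl

lemma excursionMean_shift (ω : Env d) (α : ℝ) (w : ℕ → ℝ≥0∞) (x y z : Fin d → ℤ) :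
    excursionMean (walkKernel (shift z ω)) (strongComponent (shift z ω) α) w x y
      = excursionMean (walkKernel ω) (strongComponent ω α) w (x + z) (y + z) := by
  rw [walkKernel_shift, strongComponent_shift, excursionMean_comp_equiv]
  rfl

lemma kpow_induced_shift (ω : Env d) (α : ℝ) (n : ℕ) (x y z : Fin d → ℤ) :
    kpow (induced (walkKernel (shift z ω)) (strongComponent (shift z ω) α)) n x y
      = kpow (induced (walkKernel ω) (strongComponent ω α)) n (x + z) (y + z) := by
  have h : induced (walkKernel (shift z ω)) (strongComponent (shift z ω) α)
      = fun x y => induced (walkKernel ω) (strongComponent ω α) (Equiv.addRight z x)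
        (Equiv.addRight z y) :=
    funext fun x => funext fun y => excursionMean_shift ω α 1 x y z
  rw [h, kpow_comp_equiv]
  rfl

/-- The law with density `π_ω(0) 1{0 ∈ 𝒞}`, which is invariant for the environment seen from the
coarse-grained walk. -/
noncomputable def envMeasure (P : Measure (Env d)) (α : ℝ) : Measure (Env d) :=
  P.withDensity ((originStrong d α).indicator fun ω => weight ω 0)

lemma measurable_envDensity (hα : 0 < α) :
    Measurable ((originStrong d α).indicator fun ω => weight ω 0) :=
  (measurable_weight 0).indicator (measurableSet_mem_strongComponent hα 0)

lemma lintegral_envMeasure (hα : 0 < α) {f : Env d → ℝ≥0∞} (hf : Measurable f) :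
    ∫⁻ ω, f ω ∂envMeasure P α
      = ∫⁻ ω, (originStrong d α).indicator (fun ω => weight ω 0) ω * f ω ∂P :=
  lintegral_withDensity_eq_lintegral_mul P (measurable_envDensity hα) hf

/-- The transition operator of the environment seen from the coarse-grained walk. -/
noncomputable def envOperator (d : ℕ) (α : ℝ) : (Env d → ℝ≥0∞) →+ (Env d → ℝ≥0∞) where
  toFun f ω := ∑' x, induced (walkKernel ω) (strongComponent ω α) 0 x * f (shift x ω)
  map_zero' := by
    funext ω
    simp
  map_add' f g := by
    funext ω
    simp [mul_add, ENNReal.tsum_add]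

lemma envOperator_apply (f : Env d → ℝ≥0∞) (ω : Env d) : envOperator d α f ω
    = ∑' x, induced (walkKernel ω) (strongComponent ω α) 0 x * f (shift x ω) := rfl

lemma iterate_envOperator (f : Env d → ℝ≥0∞) (j : ℕ) (ω : Env d) : (envOperator d α)^[j] f ω
    = ∑' x, kpow (induced (walkKernel ω) (strongComponent ω α)) j 0 x * f (shift x ω) := by
  induction j generalizing ω with
  | zero =>
    rw [tsum_kpow_zero_mul _ fun x => f (shift x ω)]
    rw [Function.iterate_zero_apply, shift_zero]
  | succ j ih =>
    rw [Function.iterate_succ_apply', envOperator_apply]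
    simp only [kpow]
    rw [← tsum_tsum_mul_assoc _ _ fun x => f (shift x ω)]
    refine tsum_congr fun z => ?_
    rw [ih]
    congr 1
    rw [← (Equiv.addRight z).tsum_eq fun x => _ * f (shift x ω)]
    refine tsum_congr fun x => ?_
    rw [kpow_induced_shift, shift_shift, zero_add]
    rfl

variable [NeZero d]

/-- **Kac's formula** (upper bound): the mean duration of an excursion from the origin is
integrable. By reversibility and mass transport, being at `z` before the end of an excursion from
the origin has the same mean as starting at the origin outside the strong component and entering
it at `-z`, and the probabilities of the latter sum to at most one. -/
lemma lintegral_tsum_excursionMean_ne_top [IsProbabilityMeasure P]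
    (hP : ∀ x : Fin d → ℤ, MeasurePreserving (shift x) P P) (hα : 0 < α) :
    ∫⁻ ω, ∑' y, excursionMean (walkKernel ω) (strongComponent ω α) (fun n => n) 0 y
      ∂envMeasure P α ≠ ∞ := by
  obtain ⟨B, hB, hwB⟩ := exists_weight_le (0 : Fin d → ℤ)
  have hmT (n : ℕ) (x z : Fin d → ℤ) : Measurable fun ω : Env d =>
      (strongComponent ω α)ᶜ.indicator
        (taboo (walkKernel ω) (strongComponent ω α) n x) z :=
    (measurable_taboo hα n x z).indicator (measurableSet_mem_strongComponent hα z).compl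
  set F : ℕ → Env d → (Fin d → ℤ) → (Fin d → ℤ) → ℝ≥0∞ := fun n ω x z =>
    (strongComponent ω α).indicator (weight ω) x * (strongComponent ω α)ᶜ.indicator
      (taboo (walkKernel ω) (strongComponent ω α) n x) z
  have hF (n : ℕ) (x z : Fin d → ℤ) : Measurable fun ω => F n ω x z :=
    ((measurable_weight x).indicator (measurableSet_mem_strongComponent hα x)).mul (hmT n x z)
  have hcov (n : ℕ) (ω : Env d) (x y z : Fin d → ℤ) :
      F n (shift z ω) x y = F n ω (x + z) (y + z) := by
    classical
    simp only [F]
    rw [indicator_compl_taboo_shift, strongComponent_shift, Set.indicator_apply, weight_shift]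
    rfl
  have hsymm (n : ℕ) (ω : Env d) (z : Fin d → ℤ) : F n ω z 0 ≤ weight ω 0
      * (strongComponent ω α).indicator (taboo (walkKernel ω) (strongComponent ω α) n 0) z := by
    by_cases hz : z ∈ strongComponent ω α <;> by_cases h0 : 0 ∈ strongComponent ω α <;>
      simp [F, hz, h0, taboo_symm (walkKernel_symm ω) (strongComponent ω α) n z 0]
  have hmono : ∀ ω, (originStrong d α).indicator (fun ω => weight ω 0) ω
        * ∑' y, excursionMean (walkKernel ω) (strongComponent ω α) (fun n => n) 0 y
      ≤ weight ω 0 + ∑' n, ∑' z, F n ω 0 z := by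
    intro ω
    by_cases h0 : 0 ∈ strongComponent ω α
    · have h0' : ω ∈ originStrong d α := h0
      rw [Set.indicator_of_mem h0']
      refine (mul_le_mul_right (tsum_excursionMean_natCast_le
        (fun x => (tsum_walkKernel ω x).le) _ _) _).trans (le_of_eq ?_)
      simp only [F, Set.indicator_of_mem h0, mul_add, mul_one, ENNReal.tsum_mul_left]
    · have h0' : ω ∉ originStrong d α := h0
      rw [Set.indicator_of_notMem h0', zero_mul]
      exact zero_le
  rw [lintegral_envMeasure hα
    (Measurable.tsum fun y => measurable_excursionMean hα _ _ _)]
  refine ne_top_of_le_ne_top (ENNReal.add_ne_top.2 ⟨hB, hB⟩) ?_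
  calc _ ≤ ∫⁻ ω, (weight ω 0 + ∑' n, ∑' z, F n ω 0 z) ∂P := lintegral_mono hmono
    _ = ∫⁻ ω, weight ω 0 ∂P + ∑' n, ∫⁻ ω, ∑' z, F n ω z 0 ∂P := by
        rw [lintegral_add_left (measurable_weight 0),
          lintegral_tsum fun n => (Measurable.tsum fun z => hF n 0 z).aemeasurable]
        congr 1
        exact tsum_congr fun n => lintegral_tsum_eq_lintegral_tsum hP (hF n) (hcov n)
    _ = ∫⁻ ω, weight ω 0 ∂P + ∫⁻ ω, ∑' n, ∑' z, F n ω z 0 ∂P := by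
        rw [lintegral_tsum fun n => (Measurable.tsum fun z => hF n z 0).aemeasurable]
    _ ≤ ∫⁻ _, B ∂P + ∫⁻ _, B ∂P := by
        gcongr with ω ω
        · exact hwB ω
        · calc ∑' n, ∑' z, F n ω z 0
              ≤ ∑' n, ∑' z, weight ω 0 * (strongComponent ω α).indicator
                (taboo (walkKernel ω) (strongComponent ω α) n 0) z :=
                ENNReal.tsum_le_tsum fun n => ENNReal.tsum_le_tsum fun z => hsymm n ω z
            _ ≤ weight ω 0 := by
                simp_rw [ENNReal.tsum_mul_left]
                exact mul_le_of_le_one_right'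
                  (tsum_taboo_le_one (fun x => (tsum_walkKernel ω x).le) _ _)
            _ ≤ B := hwB ω
    _ = B + B := by simp

lemma measurable_envOperator (hP : ∀ x : Fin d → ℤ, MeasurePreserving (shift x) P P) (hα : 0 < α)
    {f : Env d → ℝ≥0∞} (hf : Measurable f) : Measurable (envOperator d α f) :=
  Measurable.tsum fun x => (measurable_excursionMean hα 1 0 x).mul (hf.comp (hP x).measurable)

lemma envOperator_const_le (c : ℝ≥0∞) : envOperator d α (fun _ => c) ≤ fun _ => c := by
  intro ω
  rw [envOperator_apply, ENNReal.tsum_mul_right]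
  exact mul_le_of_le_one_left' (tsum_induced_le_one (fun x => (tsum_walkKernel ω x).le) _ _)

lemma lintegral_envOperator_le (hP : ∀ x : Fin d → ℤ, MeasurePreserving (shift x) P P)
    (hα : 0 < α) {f : Env d → ℝ≥0∞} (hf : Measurable f) :
    ∫⁻ ω, envOperator d α f ω ∂envMeasure P α ≤ ∫⁻ ω, f ω ∂envMeasure P α := by
  set F : Env d → (Fin d → ℤ) → (Fin d → ℤ) → ℝ≥0∞ := fun ω x z =>
    weight ω x * induced (walkKernel ω) (strongComponent ω α) x z * f (shift z ω)
  have hF (x z : Fin d → ℤ) : Measurable fun ω => F ω x z :=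
    ((measurable_weight x).mul (measurable_excursionMean hα 1 x z)).mul
      (hf.comp (hP z).measurable)
  have hcov (ω : Env d) (x y z : Fin d → ℤ) : F (shift z ω) x y = F ω (x + z) (y + z) := by
    simp only [F, induced]
    rw [excursionMean_shift, shift_shift, weight_shift]
  rw [lintegral_envMeasure hα (measurable_envOperator hP hα hf), lintegral_envMeasure hα hf]
  calc _ ≤ ∫⁻ ω, ∑' z, F ω 0 z ∂P := by
        refine lintegral_mono fun ω => ?_
        simp only [F, mul_assoc, ENNReal.tsum_mul_left]
        exact mul_le_mul_left (Set.indicator_le_self _ _ _) _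
    _ = ∫⁻ ω, ∑' z, F ω z 0 ∂P := lintegral_tsum_eq_lintegral_tsum hP hF hcov
    _ ≤ _ := by
        refine lintegral_mono fun ω => ?_
        simp only [F, shift_zero]
        rw [ENNReal.tsum_mul_right]
        refine mul_le_mul_left ?_ _
        simp_rw [induced_symm (walkKernel_symm ω) (strongComponent ω α) _ 0]
        rw [ENNReal.tsum_mul_left]
        by_cases h0 : 0 ∈ strongComponent ω α
        · have h0' : ω ∈ originStrong d α := h0
          rw [Set.indicator_of_mem h0']
          exact mul_le_of_le_one_right'
            (tsum_induced_le_one (fun x => (tsum_walkKernel ω x).le) _ _)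
        · simp [induced, excursionMean_of_notMem_left h0]

/-- Almost surely on `{0 ∈ 𝒞}`, the durations of the excursions of length at least `k` have
uniformly small averages along the coarse-grained walk when `k` is large. -/
lemma ae_exists_sum_meanDuration_le [IsProbabilityMeasure P]
    (hP : ∀ x : Fin d → ℤ, MeasurePreserving (shift x) P P) (hα : 0 < α) :
    ∀ᵐ ω ∂P, 0 ∈ strongComponent ω α → ∀ e : ℝ≥0∞, e ≠ 0 → ∃ k : ℕ, ∀ l : ℕ,
      ∑ j ∈ Finset.range l, meanDuration (walkKernel ω) (strongComponent ω α) (truncation k) 0 j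
        ≤ l * e := by
  set u : ℕ → Env d → ℝ≥0∞ := fun k ω =>
    ∑' y, excursionMean (walkKernel ω) (strongComponent ω α) (truncation k) 0 y
  have hu (k : ℕ) : Measurable (u k) := Measurable.tsum fun y => measurable_excursionMean hα _ _ _
  have hle (k n : ℕ) : truncation k n ≤ n := by
    unfold truncation
    split_ifs <;> simp
  have hfin := lintegral_tsum_excursionMean_ne_top hP hα
  have hmeas : Measurable fun ω : Env d =>
      ∑' y, excursionMean (walkKernel ω) (strongComponent ω α) (fun n => n) 0 y :=
    Measurable.tsum fun y => measurable_excursionMean hα _ _ _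
  have hlim : Tendsto (fun k => ∫⁻ ω, u k ω ∂envMeasure P α) atTop (𝓝 0) := by
    have h := tendsto_lintegral_of_dominated_convergence (μ := envMeasure P α) (F := u)
      (f := fun _ => 0) _ hu (fun k => Eventually.of_forall fun ω => ?_) hfin ?_
    · simpa using h
    · refine ENNReal.tsum_le_tsum fun y => ENNReal.tsum_le_tsum fun n => ?_
      exact mul_le_mul_left (hle k (n + 1)) _
    · filter_upwards [ae_lt_top hmeas hfin] with ω hω
      set g : ℕ → ℝ≥0∞ := fun n =>
        ((n + 1 : ℕ) : ℝ≥0∞) * ∑' y, excursion (walkKernel ω) (strongComponent ω α) n 0 y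
      have hg : ∑' n, g n ≠ ∞ := by
        refine ne_of_eq_of_ne ?_ hω.ne
        simp only [excursionMean]
        rw [ENNReal.tsum_comm]
        simp_rw [ENNReal.tsum_mul_left]
        rfl
      have hug (k : ℕ) : u (k + 1) ω = ∑' n, g (n + k) := by
        simp only [u, excursionMean]
        rw [ENNReal.tsum_comm]
        simp_rw [ENNReal.tsum_mul_left]
        rw [tsum_eq_tsum_add_of_eq_zero (m := k) fun n hn => ?_]
        · refine tsum_congr fun n => ?_
          rw [truncation, if_pos (by omega)]
        · rw [truncation, if_neg (by omega), zero_mul]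
      rw [← tendsto_add_atTop_iff_nat 1]
      simp_rw [hug]
      exact ENNReal.tendsto_sum_nat_add g hg
  have hmain := ae_exists_forall_sum_iterate_le (Q := envOperator d α) envOperator_const_le
    (fun f hf => measurable_envOperator hP hα hf) (fun f hf => lintegral_envOperator_le hP hα hf)
    hu hlim
  rw [envMeasure, ae_withDensity_iff (measurable_envDensity hα)] at hmain
  filter_upwards [hmain] with ω hω h0 e he
  have h0' : ω ∈ originStrong d α := h0
  rw [Set.indicator_of_mem h0'] at hω
  obtain ⟨k, hk⟩ := hω (weight_ne_zero ω 0) e he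
  refine ⟨k, fun l => le_trans (le_of_eq ?_) (hk l)⟩
  rw [Finset.sum_apply]
  refine Finset.sum_congr rfl fun j _ => ?_
  rw [iterate_envOperator, meanDuration]
  refine tsum_congr fun x => ?_
  congr 1
  simp only [u]
  rw [← (Equiv.addRight x).tsum_eq fun y => excursionMean _ _ _ x y]
  refine tsum_congr fun y => ?_
  rw [excursionMean_shift, zero_add]
  rfl

end EnvironmentChain

/-! ### The path law and taboo kernels -/

section PathLaw

variable {d : ℕ}

lemma measurableSet_eval_mem (m : ℕ) (S : Set (Fin d → ℤ)) :
    MeasurableSet {X : ℕ → Fin d → ℤ | X m ∈ S} :=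
  (MeasurableSet.of_discrete (s := S)).preimage (measurable_pi_apply m)

lemma stepMeasure_singleton (ω : Env d) (x y : Fin d → ℤ) :
    stepMeasure ω x {y} = walkKernel ω x y := by
  rw [stepMeasure, Measure.sum_apply _ (measurableSet_singleton y), tsum_eq_single y]
  · simp [walkKernel]
  · intro z hz
    simp [hz]

variable [NeZero d]

/-- The Markov property of the path law: conditionally on the first `n` steps, the next position
has law `stepMeasure` of the present one. -/
lemma pathLaw_inter_succ (ω : Env d) (x : Fin d → ℤ) (n : ℕ)
    {A : Set (Π _ : Finset.Iic n, Fin d → ℤ)} (hA : MeasurableSet A) (z y : Fin d → ℤ)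
    (hAz : ∀ h ∈ A, h ⟨n, Finset.mem_Iic.2 le_rfl⟩ = z) :
    pathLaw ω x {X | Preorder.frestrictLe (π := fun _ => Fin d → ℤ) n X ∈ A ∧ X (n + 1) = y}
      = pathLaw ω x {X | Preorder.frestrictLe (π := fun _ => Fin d → ℤ) n X ∈ A}
        * walkKernel ω z y := by
  set κ : (n : ℕ) → Kernel (Π _ : Finset.Iic n, Fin d → ℤ) (Fin d → ℤ) :=
    fun n => (stepKernel ω).comap (fun h => h ⟨n, Finset.mem_Iic.2 le_rfl⟩) (measurable_pi_apply _)
  have h1 := Kernel.partialTraj_compProd_eq_map_traj (X := fun _ => Fin d → ℤ) (κ := κ)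
    (Nat.zero_le n) (x₀ := fun _ => x)
  have hAy : MeasurableSet (A ×ˢ ({y} : Set (Fin d → ℤ))) := hA.prod (measurableSet_singleton y)
  have hmeas : Measurable fun X : ℕ → Fin d → ℤ =>
      ((Preorder.frestrictLe (π := fun _ => Fin d → ℤ) n X : Π _ : Finset.Iic n, Fin d → ℤ),
        X (n + 1)) :=
    (Preorder.measurable_frestrictLe n).prodMk (measurable_pi_apply _)
  have h2 : pathLaw ω x {X | Preorder.frestrictLe (π := fun _ => Fin d → ℤ) n X ∈ A ∧ X (n + 1) = y}
      = (Kernel.partialTraj (X := fun _ => Fin d → ℤ) κ 0 n (fun _ => x) ⊗ₘ κ n)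
        (A ×ˢ {y}) := by
    rw [h1, Measure.map_apply hmeas hAy]
    rfl
  have h3 : pathLaw ω x {X | Preorder.frestrictLe (π := fun _ => Fin d → ℤ) n X ∈ A}
      = Kernel.partialTraj (X := fun _ => Fin d → ℤ) κ 0 n (fun _ => x) A := by
    rw [← Kernel.traj_map_frestrictLe_apply,
      Measure.map_apply (Preorder.measurable_frestrictLe n) hA]
    rfl
  rw [h2, h3, Measure.compProd_apply_prod hA (measurableSet_singleton y)]
  rw [setLIntegral_congr_fun (g := fun _ => walkKernel ω z y) hA, setLIntegral_const, mul_comm]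
  intro h hh
  have h4 : κ n h {y} = stepMeasure ω (h ⟨n, Finset.mem_Iic.2 le_rfl⟩) {y} := rfl
  change κ n h {y} = _
  rw [h4, stepMeasure_singleton, hAz h hh]

lemma pathLaw_zero_eq (ω : Env d) (x : Fin d → ℤ) : pathLaw ω x {X | X 0 = x} = 1 := by
  set κ : (n : ℕ) → Kernel (Π _ : Finset.Iic n, Fin d → ℤ) (Fin d → ℤ) :=
    fun n => (stepKernel ω).comap (fun h => h ⟨n, Finset.mem_Iic.2 le_rfl⟩) (measurable_pi_apply _)
  have hA : MeasurableSet
      {h : Π _ : Finset.Iic 0, Fin d → ℤ | h ⟨0, Finset.mem_Iic.2 le_rfl⟩ = x} :=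
    (measurableSet_singleton x).preimage (measurable_pi_apply _)
  have h := Kernel.traj_map_frestrictLe_apply (X := fun _ => Fin d → ℤ) (κ := κ) 0 0 (fun _ => x)
  rw [Kernel.partialTraj_self, Kernel.id_apply] at h
  have h2 := congrArg (fun m => m {h : Π _ : Finset.Iic 0, Fin d → ℤ |
    h ⟨0, Finset.mem_Iic.2 le_rfl⟩ = x}) h
  rw [Measure.map_apply (Preorder.measurable_frestrictLe 0) hA, Measure.dirac_apply' _ hA] at h2
  exact h2.trans (by simp)

/-- The law of the walk up to its first positive time in `C` is given by the taboo kernels. -/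
lemma pathLaw_eq_taboo (ω : Env d) (C : Set (Fin d → ℤ)) (x : Fin d → ℤ) (n : ℕ)
    (y : Fin d → ℤ) :
    pathLaw ω x {X | (∀ m, 1 ≤ m → m < n + 1 → X m ∉ C) ∧ X (n + 1) = y}
      = taboo (walkKernel ω) C n x y := by
  induction n generalizing y with
  | zero =>
    have hA : MeasurableSet
        {h : Π _ : Finset.Iic 0, Fin d → ℤ | h ⟨0, Finset.mem_Iic.2 le_rfl⟩ = x} :=
      (measurableSet_singleton x).preimage (measurable_pi_apply _)
    have h := pathLaw_inter_succ ω x 0 hA x y fun h hh => hh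
    have h0 : pathLaw ω x {X | X 0 = x}ᶜ = 0 := by
      have : IsProbabilityMeasure (pathLaw ω x) := by unfold pathLaw; infer_instance
      exact (prob_compl_eq_zero_iff (measurableSet_eval_mem 0 {x})).2 (pathLaw_zero_eq ω x)
    have h1 : pathLaw ω x {X | Preorder.frestrictLe (π := fun _ => Fin d → ℤ) 0 X ∈
        {h : Π _ : Finset.Iic 0, Fin d → ℤ | h ⟨0, Finset.mem_Iic.2 le_rfl⟩ = x}} = 1 :=
      pathLaw_zero_eq ω x
    rw [h1, one_mul] at h
    refine Eq.trans (measure_congr ?_) h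
    have hae : ∀ᵐ X ∂pathLaw ω x, X 0 = x := h0
    filter_upwards [hae] with X hX
    refine propext ⟨fun hy => ⟨hX, hy.2⟩, fun hy => ⟨fun m h1 h2 => ?_, hy.2⟩⟩
    omega
  | succ n ih =>
    set A : (Fin d → ℤ) → Set (Π _ : Finset.Iic (n + 1), Fin d → ℤ) := fun z =>
      {h | (∀ m (hm : m < n + 1), 1 ≤ m → h ⟨m, Finset.mem_Iic.2 hm.le⟩ ∉ C)
        ∧ h ⟨n + 1, Finset.mem_Iic.2 le_rfl⟩ = z}
    have hA (z : Fin d → ℤ) : MeasurableSet (A z) := by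
      refine MeasurableSet.inter ?_ ((measurableSet_singleton z).preimage (measurable_pi_apply _))
      have e : {h : Π _ : Finset.Iic (n + 1), Fin d → ℤ |
          ∀ m (hm : m < n + 1), 1 ≤ m → h ⟨m, Finset.mem_Iic.2 hm.le⟩ ∉ C}
          = ⋂ (m) (hm : m < n + 1) (_ : 1 ≤ m),
            {h | h ⟨m, Finset.mem_Iic.2 hm.le⟩ ∉ C} := by
        ext h
        simp
      change MeasurableSet {h : Π _ : Finset.Iic (n + 1), Fin d → ℤ |
          ∀ m (hm : m < n + 1), 1 ≤ m → h ⟨m, Finset.mem_Iic.2 hm.le⟩ ∉ C}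
      rw [e]
      refine MeasurableSet.iInter fun m => MeasurableSet.iInter fun hm => MeasurableSet.iInter
        fun _ => ?_
      exact (MeasurableSet.of_discrete (s := Cᶜ)).preimage
        (measurable_pi_apply (⟨m, Finset.mem_Iic.2 hm.le⟩ : Finset.Iic (n + 1)))
    have hP (z : Fin d → ℤ) :
        pathLaw ω x {X | Preorder.frestrictLe (π := fun _ => Fin d → ℤ) (n + 1) X ∈ A z}
        = taboo (walkKernel ω) C n x z := by
      rw [← ih z]
      congr 1
      ext X
      exact and_congr_left' ⟨fun h m h1 h2 => h m h2 h1, fun h m h2 h1 => h m h1 h2⟩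
    have e : {X : ℕ → Fin d → ℤ | (∀ m, 1 ≤ m → m < n + 1 + 1 → X m ∉ C) ∧ X (n + 1 + 1) = y}
        = ⋃ z : (Cᶜ : Set (Fin d → ℤ)),
          {X | Preorder.frestrictLe (π := fun _ => Fin d → ℤ) (n + 1) X ∈ A z
            ∧ X (n + 1 + 1) = y} := by
      ext X
      simp only [Set.mem_iUnion]
      constructor
      · rintro ⟨h1, h2⟩
        exact ⟨⟨X (n + 1), h1 _ (by omega) (by omega)⟩,
          ⟨fun m hm h1m => h1 m h1m (by omega), rfl⟩, h2⟩
      · rintro ⟨z, ⟨h1, h2⟩, h3⟩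
        refine ⟨fun m h1m hm => ?_, h3⟩
        rcases Nat.lt_succ_iff_lt_or_eq.1 hm with hm | rfl
        · exact h1 m hm h1m
        · have h2' : X (n + 1) = z := h2
          rw [h2']
          exact z.2
    rw [e, measure_iUnion, taboo_succ']
    · rw [← tsum_subtype_eq_of_support_subset (s := Cᶜ)]
      · refine tsum_congr fun z => ?_
        rw [pathLaw_inter_succ ω x (n + 1) (hA z) z y fun h hh => hh.2, hP,
          Set.indicator_of_mem z.2]
      · intro z hz
        by_contra hzC
        exact hz (by simp [Set.indicator_of_notMem hzC])
    · intro z z' hzz'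
      rw [Function.onFun, Set.disjoint_left]
      rintro X ⟨⟨-, h2⟩, -⟩ ⟨⟨-, h2'⟩, -⟩
      exact hzz' (Subtype.ext (h2.symm.trans h2'))
    · intro z
      exact ((hA z).preimage (Preorder.measurable_frestrictLe (n + 1))).inter
        ((measurableSet_singleton y).preimage (measurable_pi_apply _))

lemma coarseTransProb_eq_toReal (ω : Env d) (α : ℝ) (x y : Fin d → ℤ) :
    coarseTransProb ω α x y = (∑' n, (strongComponent ω α).indicator
      (taboo (walkKernel ω) (strongComponent ω α) n x) y).toReal := by
  rw [coarseTransProb, Measure.real]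
  congr 1
  by_cases hy : y ∈ strongComponent ω α
  · simp_rw [Set.indicator_of_mem hy, ← pathLaw_eq_taboo]
    have e : firstReturnAt (strongComponent ω α) y = ⋃ n : ℕ, {X |
        (∀ m, 1 ≤ m → m < n + 1 → X m ∉ strongComponent ω α) ∧ X (n + 1) = y} := by
      ext X
      simp only [Set.mem_iUnion]
      constructor
      · rintro ⟨n, h1, -, h3, h4⟩
        obtain ⟨k, rfl⟩ := Nat.exists_eq_add_of_le' h1
        exact ⟨k, h3, h4⟩
      · rintro ⟨n, h3, h4⟩
        exact ⟨n + 1, by omega, by rw [h4]; exact hy, h3, h4⟩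
    rw [e, measure_iUnion]
    · intro i j hij
      rw [Function.onFun, Set.disjoint_left]
      rintro X ⟨h1, h2⟩ ⟨h3, h4⟩
      rcases lt_or_gt_of_ne hij with h | h
      · exact h3 (i + 1) (by omega) (by omega) (by rw [h2]; exact hy)
      · exact h1 (j + 1) (by omega) (by omega) (by rw [h4]; exact hy)
    · intro n
      have e' : {X : ℕ → Fin d → ℤ |
          (∀ m, 1 ≤ m → m < n + 1 → X m ∉ strongComponent ω α) ∧ X (n + 1) = y}
          = (⋂ (m : ℕ) (_ : 1 ≤ m) (_ : m < n + 1), {X | X m ∈ (strongComponent ω α)ᶜ})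
            ∩ {X | X (n + 1) = y} := by
        ext X
        simp
      rw [e']
      refine MeasurableSet.inter ?_ (measurableSet_eval_mem _ {y})
      refine MeasurableSet.iInter fun m => MeasurableSet.iInter fun _ => MeasurableSet.iInter
        fun _ => ?_
      exact measurableSet_eval_mem m _
  · have e : firstReturnAt (strongComponent ω α) y = ∅ := by
      ext X
      simp only [Set.mem_empty_iff_false, iff_false]
      rintro ⟨n, -, h2, -, h4⟩
      exact hy (h4 ▸ h2)
    simp [e, hy]

lemma coarseTransProb_of_mem {ω : Env d} {α : ℝ} {x : Fin d → ℤ} (hx : x ∈ strongComponent ω α)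
    (y : Fin d → ℤ) : coarseTransProb ω α x y
      = (induced (walkKernel ω) (strongComponent ω α) x y).toReal := by
  rw [coarseTransProb_eq_toReal, induced_apply]
  congr 1
  refine tsum_congr fun n => ?_
  by_cases hy : y ∈ strongComponent ω α <;> simp [excursion, hx, hy]

lemma coarseTransProb_of_notMem {ω : Env d} {α : ℝ} (x : Fin d → ℤ) {y : Fin d → ℤ}
    (hy : y ∉ strongComponent ω α) : coarseTransProb ω α x y = 0 := by
  simp [coarseTransProb_eq_toReal, hy]

lemma nFold_coarseTransProb {ω : Env d} {α : ℝ} (n : ℕ) {x : Fin d → ℤ}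
    (hx : x ∈ strongComponent ω α) (y : Fin d → ℤ) : nFold (coarseTransProb ω α) n x y
      = (kpow (induced (walkKernel ω) (strongComponent ω α)) n x y).toReal := by
  have h1 := tsum_induced_le_one (fun x => (tsum_walkKernel ω x).le) (strongComponent ω α)
  induction n generalizing x with
  | zero =>
    simp only [nFold, kpow]
    split_ifs <;> simp
  | succ n ih =>
    simp only [nFold, kpow]
    rw [ENNReal.tsum_toReal_eq]
    · refine tsum_congr fun z => ?_
      rw [ENNReal.toReal_mul]
      by_cases hz : z ∈ strongComponent ω α
      · rw [ih hz, coarseTransProb_of_mem hx]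
      · rw [coarseTransProb_of_notMem x hz, induced, excursionMean_of_notMem_right x hz]
        simp
    · intro z
      refine ENNReal.mul_ne_top ?_ ?_
      · exact ne_top_of_le_ne_top ENNReal.one_ne_top ((ENNReal.le_tsum z).trans (h1 x))
      · exact ne_top_of_le_ne_top ENNReal.one_ne_top (kpow_le_one h1 n z y)

lemma nFold_transProb (ω : Env d) (n : ℕ) (x y : Fin d → ℤ) :
    nFold (transProb ω) n x y = (kpow (walkKernel ω) n x y).toReal := by
  have h1 (x : Fin d → ℤ) := (tsum_walkKernel ω x).le
  induction n generalizing x with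
  | zero =>
    simp only [nFold, kpow]
    split_ifs <;> simp
  | succ n ih =>
    simp only [nFold, kpow]
    rw [ENNReal.tsum_toReal_eq]
    · refine tsum_congr fun z => ?_
      rw [ENNReal.toReal_mul, ih, walkKernel, ENNReal.toReal_ofReal]
      exact div_nonneg (conductance_nonneg ω x z) (totalConductance_pos ω x).le
    · intro z
      refine ENNReal.mul_ne_top ENNReal.ofReal_ne_top ?_
      exact ne_top_of_le_ne_top ENNReal.one_ne_top (kpow_le_one h1 n z y)

end PathLaw

/-! ### From visits to the decay of return probabilities -/

section Asymptotics

/-- From bounds on the return probabilities `v N l` at the `l`-th visit, after time `N`, to the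
decay of the averages `p N`. For `2 * l * k ≤ N` the second bound on `v` has the small factor `ε`;
for the larger `l` the first bound is used, at the cost of a factor `2 * k * l / N`, and these `l`
contribute only the order of `N ^ (2 - s)`. -/
lemma isLittleO_of_visit_bounds {p : ℕ → ℝ} {v : ℕ → ℕ → ℝ} {A s : ℝ} {G : ℕ → ℝ} (hA : 0 ≤ A)
    (hs : 1 ≤ s) (hp0 : ∀ N, 0 ≤ p N) (hv0 : ∀ N l, 0 ≤ v N l)
    (hp : ∀ N : ℕ, N * p N ≤ 2 * ∑ l ∈ Finset.range (2 * N + 1), v N l)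
    (hvz : ∀ N, 1 ≤ N → v N 0 = 0)
    (hv : ∀ N l : ℕ, 1 ≤ l → v N l ≤ A * (l : ℝ) ^ (-s))
    (hv' : ∀ ε : ℝ, 0 < ε → ∃ k : ℕ, ∀ N l : ℕ, 1 ≤ l →
      ((N : ℝ) - l * k) * v N l ≤ A * ε * (l : ℝ) ^ (1 - s))
    (hG : (fun N : ℕ => ∑ l ∈ Finset.range (2 * N), ((l + 1 : ℕ) : ℝ) ^ (1 - s)) =O[atTop] G)
    (hG' : (fun N : ℕ => (N : ℝ) ^ (2 - s)) =o[atTop] G) :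
    (fun N : ℕ => (N : ℝ) ^ 2 * p N) =o[atTop] G := by
  obtain ⟨c, hc, hGc⟩ := hG.exists_pos
  rw [isLittleO_iff]
  intro e he
  set ε : ℝ := e / (2 * (4 * (A + 1) * c)) with hε
  have hεpos : 0 < ε := by positivity
  obtain ⟨k₀, hk₀⟩ := hv' ε hεpos
  set k := k₀ + 1
  -- The bound persists when the threshold is raised, so the threshold may be taken positive.
  have hk (N l : ℕ) (hl : 1 ≤ l) :
      ((N : ℝ) - l * k) * v N l ≤ A * ε * (l : ℝ) ^ (1 - s) := by
    refine le_trans ?_ (hk₀ N l hl)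
    refine mul_le_mul_of_nonneg_right ?_ (hv0 N l)
    have : (l : ℝ) * k₀ ≤ l * k := by
      gcongr
      simp [k]
    linarith
  have hkpos : (0 : ℝ) < k := by positivity
  set M : ℝ := 4 * A * k * (2 * (2 * k) ^ (s - 1)) with hM
  have hM0 : 0 ≤ M := by positivity
  have hMlim := hG'.const_mul_left M
  have hMev := (isLittleO_iff.1 hMlim) (half_pos he)
  filter_upwards [hGc.bound, hMev, eventually_ge_atTop 1] with N h1 h2 hN
  have hNpos : (0 : ℝ) < N := by exact_mod_cast hN
  have hterm (l : ℕ) (hl : l ∈ Finset.range (2 * N)) : (N : ℝ) * v N (l + 1)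
      ≤ 2 * A * ε * ((l + 1 : ℕ) : ℝ) ^ (1 - s)
        + 2 * A * k * ((2 * k) ^ (s - 1) * (N : ℝ) ^ (1 - s)) := by
    set L : ℝ := ((l + 1 : ℕ) : ℝ) with hL
    have hLpos : 0 < L := by positivity
    have hx0 : 0 ≤ 2 * A * ε * L ^ (1 - s) := by positivity
    have hy0 : 0 ≤ 2 * A * k * ((2 * k) ^ (s - 1) * (N : ℝ) ^ (1 - s)) := by positivity
    rcases le_or_gt (2 * L * k) N with h | h
    · have h3 := hk N (l + 1) (by omega)
      rw [← hL] at h3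
      have h4 : (N : ℝ) / 2 * v N (l + 1) ≤ (N - L * k) * v N (l + 1) :=
        mul_le_mul_of_nonneg_right (by linarith) (hv0 _ _)
      linarith
    · have h3 := hv N (l + 1) (by omega)
      rw [← hL] at h3
      have h5 : L ^ (1 - s) = L * L ^ (-s) := by
        rw [sub_eq_add_neg, Real.rpow_add hLpos, Real.rpow_one]
      have h6 : L ^ (1 - s) ≤ (2 * k) ^ (s - 1) * (N : ℝ) ^ (1 - s) := by
        have h7 : (N : ℝ) / (2 * k) ≤ L := by
          rw [div_le_iff₀ (by positivity)]
          linarith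
        have h8 := Real.rpow_le_rpow_of_nonpos (by positivity) h7 (by linarith : 1 - s ≤ 0)
        refine h8.trans (le_of_eq ?_)
        rw [Real.div_rpow hNpos.le (by positivity), div_eq_mul_inv, ← Real.rpow_neg (by positivity),
          neg_sub, mul_comm]
      calc (N : ℝ) * v N (l + 1) ≤ (2 * L * k) * (A * L ^ (-s)) :=
            mul_le_mul h.le h3 (hv0 _ _) (by positivity)
        _ = 2 * A * k * L ^ (1 - s) := by rw [h5]; ring
        _ ≤ 2 * A * k * ((2 * k) ^ (s - 1) * (N : ℝ) ^ (1 - s)) := by gcongr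
        _ ≤ _ := le_add_of_nonneg_left hx0
  set S : ℝ := ∑ l ∈ Finset.range (2 * N), ((l + 1 : ℕ) : ℝ) ^ (1 - s)
  have hS0 : 0 ≤ S := Finset.sum_nonneg fun l _ => by positivity
  have hmain : (N : ℝ) ^ 2 * p N ≤ 4 * A * ε * S + M * (N : ℝ) ^ (2 - s) := by
    calc (N : ℝ) ^ 2 * p N = N * (N * p N) := by ring
      _ ≤ N * (2 * ∑ l ∈ Finset.range (2 * N + 1), v N l) :=
          mul_le_mul_of_nonneg_left (hp N) hNpos.le
      _ = 2 * ∑ l ∈ Finset.range (2 * N), N * v N (l + 1) := by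
          rw [Finset.sum_range_succ', hvz N hN, add_zero, ← Finset.mul_sum]
          ring
      _ ≤ 2 * ∑ l ∈ Finset.range (2 * N), (2 * A * ε * ((l + 1 : ℕ) : ℝ) ^ (1 - s)
            + 2 * A * k * ((2 * k) ^ (s - 1) * (N : ℝ) ^ (1 - s))) := by
          gcongr with l hl
          exact hterm l hl
      _ = 4 * A * ε * S + M * (N * (N : ℝ) ^ (1 - s)) := by
          rw [Finset.sum_add_distrib, ← Finset.mul_sum, Finset.sum_const, Finset.card_range,
            nsmul_eq_mul, Nat.cast_mul, Nat.cast_ofNat]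
          ring
      _ = _ := by
          rw [show 2 - s = 1 + (1 - s) by ring, Real.rpow_add hNpos, Real.rpow_one]
  rw [Real.norm_of_nonneg (mul_nonneg (by positivity) (hp0 N))]
  rw [Real.norm_of_nonneg hS0] at h1
  rw [Real.norm_of_nonneg (by positivity)] at h2
  have h3 : 4 * A * ε * S ≤ e / 2 * ‖G N‖ := by
    calc 4 * A * ε * S ≤ 4 * (A + 1) * ε * (c * ‖G N‖) := by
          gcongr
          linarith
      _ = e / 2 * ‖G N‖ := by
          rw [hε]
          field_simp
  linarith

end Asymptotics

/-! ### The quenched estimate -/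

section Quenched

variable {d : ℕ} [NeZero d] {ω : Env d} {α : ℝ}

/-- The power `s` of the heat kernel bound may be lowered, and time zero included. -/
lemma exists_kpow_le (h0 : (0 : Fin d → ℤ) ∈ strongComponent ω α) {s : ℝ} (hs : 0 ≤ s)
    (hsd : s ≤ (d : ℝ) / 2) {C : ℝ} (hC : ∀ n : ℕ, 1 ≤ n → ∀ y ∈ strongComponent ω α,
      nFold (coarseTransProb ω α) n 0 y ≤ C / (n : ℝ) ^ ((d : ℝ) / 2)) :
    ∃ D : ℝ, 0 ≤ D ∧ ∀ m y, kpow (induced (walkKernel ω) (strongComponent ω α)) m 0 y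
      ≤ ENNReal.ofReal (D * ((m + 1 : ℕ) : ℝ) ^ (-s)) := by
  set K := induced (walkKernel ω) (strongComponent ω α)
  have hK := tsum_induced_le_one (fun x => (tsum_walkKernel ω x).le) (strongComponent ω α)
  have htop (m : ℕ) (y : Fin d → ℤ) : kpow K m 0 y ≠ ∞ :=
    ne_top_of_le_ne_top ENNReal.one_ne_top (kpow_le_one hK m 0 y)
  refine ⟨max 1 (|C| * 2 ^ s), by positivity, fun m y => ?_⟩
  rw [← ENNReal.ofReal_toReal (htop m y)]
  refine ENNReal.ofReal_le_ofReal ?_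
  rcases m with _ | m
  · simp only [zero_add, Nat.cast_one, Real.one_rpow, mul_one]
    exact (ENNReal.toReal_mono ENNReal.one_ne_top (kpow_le_one hK 0 0 y)).trans (by simp)
  · by_cases hy : y ∈ strongComponent ω α
    · have h1 := hC (m + 1) (by omega) y hy
      rw [nFold_coarseTransProb _ h0] at h1
      set t : ℝ := ((m + 1 : ℕ) : ℝ) with ht
      have ht1 : 1 ≤ t := by rw [ht]; push_cast; linarith [m.cast_nonneg (α := ℝ)]
      have ht2 : ((m + 1 + 1 : ℕ) : ℝ) = t + 1 := by rw [ht]; push_cast; ring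
      rw [ht2]
      calc (kpow K (m + 1) 0 y).toReal ≤ C / t ^ ((d : ℝ) / 2) := h1
        _ ≤ |C| / t ^ s := by
            gcongr
            exact le_abs_self C
        _ = |C| * 2 ^ s * (2 * t) ^ (-s) := by
            rw [Real.mul_rpow (by norm_num) (by positivity), Real.rpow_neg (by norm_num),
              Real.rpow_neg (by positivity)]
            have h2s : (2 : ℝ) ^ s ≠ 0 := by positivity
            field_simp
        _ ≤ max 1 (|C| * 2 ^ s) * (t + 1) ^ (-s) := by
            gcongr ?_ * ?_
            · exact le_max_right _ _
            · exact Real.rpow_le_rpow_of_nonpos (by positivity) (by linarith) (by linarith)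
    · have h2 : kpow K (m + 1) 0 y = 0 := by
        rw [kpow_succ', ENNReal.tsum_eq_zero]
        intro z
        rw [show K z y = 0 from excursionMean_of_notMem_right z hy, mul_zero]
      rw [h2, ENNReal.toReal_zero]
      positivity

/-- The quenched estimate for an environment in which the heat kernel of the coarse-grained walk
decays like `n ^ (-s)` and the long excursions have small averages. -/
lemma isLittleO_of_kpow_le (hα : 0 < α) (h0 : (0 : Fin d → ℤ) ∈ strongComponent ω α) {s D : ℝ}
    (hs : 1 ≤ s) (hD : 0 ≤ D)
    (hb : ∀ m y, kpow (induced (walkKernel ω) (strongComponent ω α)) m 0 y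
      ≤ ENNReal.ofReal (D * ((m + 1 : ℕ) : ℝ) ^ (-s)))
    (hk : ∀ e : ℝ≥0∞, e ≠ 0 → ∃ k : ℕ, ∀ l : ℕ, ∑ j ∈ Finset.range l,
      meanDuration (walkKernel ω) (strongComponent ω α) (truncation k) 0 j ≤ l * e) {G : ℕ → ℝ}
    (hG : (fun N : ℕ => ∑ l ∈ Finset.range (2 * N), ((l + 1 : ℕ) : ℝ) ^ (1 - s)) =O[atTop] G)
    (hG' : (fun N : ℕ => (N : ℝ) ^ (2 - s)) =o[atTop] G) :
    (fun N : ℕ => (N : ℝ) ^ 2 * nFold (transProb ω) (2 * N) 0 0) =o[atTop] G := by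
  have hw1 (x : Fin d → ℤ) := (tsum_walkKernel ω x).le
  set C := strongComponent ω α
  set f : ℕ → ℕ → ℝ≥0∞ := fun N => (Set.Icc N (2 * N)).indicator 1
  have hf (N t : ℕ) : f N t ≤ 1 := Set.indicator_le_self _ _ _
  have hfN (N t : ℕ) (ht : t < N) : f N t = 0 :=
    Set.indicator_of_notMem (fun h => ht.not_ge h.1) _
  set b : ℕ → ℝ≥0∞ := fun m => ENNReal.ofReal (D * ((m + 1 : ℕ) : ℝ) ^ (-s))
  have hb' : Antitone b := by
    intro i j hij
    refine ENNReal.ofReal_le_ofReal (mul_le_mul_of_nonneg_left ?_ hD)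
    exact Real.rpow_le_rpow_of_nonpos (by positivity) (by exact_mod_cast by omega) (by linarith)
  set V : ℕ → ℕ → ℝ≥0∞ := fun N l => visit (walkKernel ω) C 0 (f N) l 0 0
  have hVle (N l : ℕ) : V N l ≤ b l := (visit_le_kpow (hf N) l 0 0).trans (hb l 0)
  have hVtop (N l : ℕ) : V N l ≠ ∞ := ne_top_of_le_ne_top ENNReal.ofReal_ne_top (hVle N l)
  set R : ℝ := totalConductance ω 0 / α
  have hR : weight ω 0 / ENNReal.ofReal α = ENNReal.ofReal R :=
    (ENNReal.ofReal_div_of_pos hα).symm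
  have hR0 : 0 ≤ R := div_nonneg (totalConductance_pos ω 0).le hα.le
  have hlen (l : ℕ) (hl : 1 ≤ l) :
      (((l - 1) / 2 + 1 : ℕ) : ℝ) ^ (-s) ≤ 2 ^ s * (l : ℝ) ^ (-s) := by
    have hl0 : (0 : ℝ) < l := by exact_mod_cast hl
    have h1 : (l : ℝ) / 2 ≤ (((l - 1) / 2 + 1 : ℕ) : ℝ) := by
      rw [div_le_iff₀ two_pos]
      exact_mod_cast (by omega : l ≤ ((l - 1) / 2 + 1) * 2)
    refine (Real.rpow_le_rpow_of_nonpos (by positivity) h1 (by linarith)).trans (le_of_eq ?_)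
    rw [Real.div_rpow hl0.le two_pos.le, Real.rpow_neg two_pos.le, div_inv_eq_mul, mul_comm]
  refine isLittleO_of_visit_bounds (A := D * (1 + 2 * R * 2 ^ s)) (v := fun N l => (V N l).toReal)
    (by positivity) hs ?_ (fun _ _ => ENNReal.toReal_nonneg) ?_ ?_ ?_ ?_ hG hG'
  · intro N
    rw [nFold_transProb]
    exact ENNReal.toReal_nonneg
  · intro N
    have h1 := mul_kpow_two_mul_le (walkKernel_symm ω) hw1 (weight_ne_zero ω 0) (weight_ne_top ω 0)
      h0 N
    have h2 := ENNReal.toReal_mono (ENNReal.mul_ne_top ENNReal.ofNat_ne_top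
      (ENNReal.sum_ne_top.2 fun l _ => hVtop N l)) h1
    rw [ENNReal.toReal_mul, ENNReal.toReal_mul, ENNReal.toReal_sum fun l _ => hVtop N l] at h2
    rw [nFold_transProb]
    simpa using h2
  · intro N hN
    have : V N 0 = 0 := by simp [V, visit, hfN N 0 hN]
    rw [this, ENNReal.toReal_zero]
  · intro N l hl
    have hl0 : (0 : ℝ) < l := by exact_mod_cast hl
    calc (V N l).toReal ≤ D * ((l + 1 : ℕ) : ℝ) ^ (-s) :=
          ENNReal.toReal_le_of_le_ofReal (by positivity) (hVle N l)
      _ ≤ D * (1 + 2 * R * 2 ^ s) * (l : ℝ) ^ (-s) := by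
          gcongr ?_ * ?_
          · exact le_mul_of_one_le_right hD (le_add_of_nonneg_right (by positivity))
          · exact Real.rpow_le_rpow_of_nonpos hl0 (by push_cast; linarith) (by linarith)
  · intro ε hε
    obtain ⟨k, hk⟩ := hk (ENNReal.ofReal ε) (ENNReal.ofReal_pos.2 hε).ne'
    refine ⟨k, fun N l hl => ?_⟩
    have hl0 : (0 : ℝ) < l := by exact_mod_cast hl
    have h1 : ((N - 0 - l * k : ℕ) : ℝ≥0∞) * V N l ≤ ENNReal.ofReal
        (2 * R * (D * (((l - 1) / 2 + 1 : ℕ) : ℝ) ^ (-s)) * (l * ε)) := by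
      calc _ ≤ excursionSum (walkKernel ω) C (truncation k) 0 l 0 :=
            sub_mul_visit_le (hf N) (hfN N) k l 0 0
        _ ≤ 2 * (weight ω 0 / ENNReal.ofReal α) * b ((l - 1) / 2)
              * ∑ j ∈ Finset.range l, meanDuration (walkKernel ω) C (truncation k) 0 j :=
            excursionSum_le (walkKernel_symm ω) (ENNReal.ofReal_pos.2 hα).ne' ENNReal.ofReal_ne_top
              (fun x hx => le_weight_of_mem_strongComponent hx) hb hb' _ l
        _ ≤ 2 * (weight ω 0 / ENNReal.ofReal α) * b ((l - 1) / 2) * (l * ENNReal.ofReal ε) := by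
            gcongr
            exact hk l
        _ = _ := by
            rw [hR, ENNReal.ofReal_mul (by positivity), ENNReal.ofReal_mul (by positivity),
              ENNReal.ofReal_mul zero_le_two, ENNReal.ofReal_mul l.cast_nonneg,
              ENNReal.ofReal_natCast, ENNReal.ofReal_ofNat]
    have h2 := ENNReal.toReal_le_of_le_ofReal (by positivity) h1
    rw [ENNReal.toReal_mul, ENNReal.toReal_natCast, Nat.sub_zero] at h2
    have h3 : (N : ℝ) - l * k ≤ ((N - l * k : ℕ) : ℝ) := by
      have : (N : ℝ) ≤ ((N - l * k + l * k : ℕ) : ℝ) := by exact_mod_cast le_tsub_add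
      push_cast at this
      linarith
    calc ((N : ℝ) - l * k) * (V N l).toReal
        ≤ ((N - l * k : ℕ) : ℝ) * (V N l).toReal := by gcongr
      _ ≤ 2 * R * (D * (((l - 1) / 2 + 1 : ℕ) : ℝ) ^ (-s)) * (l * ε) := h2
      _ ≤ 2 * R * (D * (2 ^ s * (l : ℝ) ^ (-s))) * (l * ε) := by
          gcongr
          exact hlen l hl
      _ = D * (2 * R * 2 ^ s) * ε * (l : ℝ) ^ (1 - s) := by
          rw [sub_eq_add_neg, Real.rpow_add hl0, Real.rpow_one]
          ring
      _ ≤ D * (1 + 2 * R * 2 ^ s) * ε * (l : ℝ) ^ (1 - s) := by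
          gcongr
          linarith

end Quenched

/-! ### Almost sure decay -/

section Main

variable {d : ℕ} {P : Measure (Env d)} [IsProbabilityMeasure P]

lemma ae_of_ae_condLaw {α : ℝ} (hα : 0 < α) {p : Env d → Prop} (h : ∀ᵐ ω ∂condLaw P α, p ω) :
    ∀ᵐ ω ∂P, 0 ∈ strongComponent ω α → p ω := by
  rw [condLaw, ProbabilityTheory.cond, Measure.ae_ennreal_smul_measure_iff
    (ENNReal.inv_ne_zero.2 (measure_ne_top P _))] at h
  exact (ae_restrict_iff' (measurableSet_mem_strongComponent hα 0)).1 h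

variable [NeZero d]

lemma ae_isLittleO (hA1 : ErgodicLaw P) (hA2 : StrongComponentsExhaust P)
    (hA4 : CoarseHeatKernelBound P) {s : ℝ} (hs : 1 ≤ s) (hsd : s ≤ (d : ℝ) / 2) {G : ℕ → ℝ}
    (hG : (fun N : ℕ => ∑ l ∈ Finset.range (2 * N), ((l + 1 : ℕ) : ℝ) ^ (1 - s)) =O[atTop] G)
    (hG' : (fun N : ℕ => (N : ℝ) ^ (2 - s)) =o[atTop] G) :
    ∀ᵐ ω ∂P, (fun N : ℕ => (N : ℝ) ^ 2 * nFold (transProb ω) (2 * N) 0 0) =o[atTop] G := by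
  obtain ⟨α₀, ⟨hα₀, -⟩, hbound⟩ := hA4
  have hα (i : ℕ) : α₀ / (i + 2) ∈ Set.Ioo 0 α₀ :=
    ⟨by positivity, div_lt_self hα₀ (by linarith [i.cast_nonneg (α := ℝ)])⟩
  have h1 := ae_all_iff.2 fun i : ℕ =>
    ae_of_ae_condLaw (hα i).1 (hbound _ (hα i) 1 zero_lt_one)
  have h2 := ae_all_iff.2 fun i : ℕ =>
    ae_exists_sum_meanDuration_le hA1.measurePreserving (hα i).1
  filter_upwards [h1, h2, hA2] with ω h1 h2 h3
  have h4 : (0 : Fin d → ℤ) ∈ ⋃ β ∈ Set.Ioi (0 : ℝ), strongComponent ω β := h3 ▸ Set.mem_univ _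
  simp only [Set.mem_iUnion, Set.mem_Ioi] at h4
  obtain ⟨β, hβ, h0β⟩ := h4
  obtain ⟨i, hi⟩ := exists_nat_gt (α₀ / β)
  have h0 : (0 : Fin d → ℤ) ∈ strongComponent ω (α₀ / (i + 2)) := by
    refine strongComponent_anti ω ?_ h0β
    rw [div_le_iff₀ (by positivity)]
    rw [div_lt_iff₀ hβ] at hi
    nlinarith
  obtain ⟨C, hC⟩ := h1 i h0
  have hdist : markovDist ω (α₀ / (i + 2)) 0 0 = 0 := by
    refine le_antisymm (iInf₂_le_of_le 0 ?_ (by simp)) zero_le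
    simp [nFold]
  obtain ⟨D, hD, hDb⟩ := exists_kpow_le h0 (by linarith) hsd
    fun n hn y hy => hC n hn 0 h0 (by simp [hdist]) y hy
  exact isLittleO_of_kpow_le (hα i).1 h0 hs hD hDb (h2 i h0) hG hG'

end Main

end RandomConductance

open RandomConductance
theorem theorem2p5 (d : ℕ) [NeZero d] (P : Measure (Env d)) [IsProbabilityMeasure P]
    (hA1 : ErgodicLaw P) (hA2 : StrongComponentsExhaust P) (hA3 : HasWeakMoments P)
    (hA4 : CoarseHeatKernelBound P) :
    (d = 4 → ∀ᵐ ω ∂P,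
      (fun n : ℕ => nFold (transProb ω) (2 * n) 0 0) =o[atTop]
        fun n : ℕ => (n : ℝ) ^ (-2 : ℤ) * Real.log n) ∧
    (5 ≤ d → ∀ᵐ ω ∂P,
      Tendsto (fun n : ℕ => (n : ℝ) ^ 2 * nFold (transProb ω) (2 * n) 0 0) atTop (𝓝 0)) := by
  have hlog : Tendsto (fun n : ℕ => Real.log n) atTop atTop :=
    Real.tendsto_log_atTop.comp tendsto_natCast_atTop_atTop
  refine ⟨fun hd => ?_, fun hd => ?_⟩
  · have hG' : (fun N : ℕ => (N : ℝ) ^ ((2 : ℝ) - 2)) =o[atTop] fun n : ℕ => Real.log n := by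
      simp only [sub_self, Real.rpow_zero]
      exact (isLittleO_const_left.2 (Or.inr (tendsto_norm_atTop_atTop.comp hlog)))
    have hG : (fun N : ℕ => ∑ l ∈ Finset.range (2 * N), ((l + 1 : ℕ) : ℝ) ^ ((1 : ℝ) - 2))
        =O[atTop] fun n : ℕ => Real.log n := by
      refine IsBigO.of_bound 3 ?_
      filter_upwards [hlog.eventually_ge_atTop (1 + Real.log 2), eventually_ge_atTop 1]
        with N hN hN1
      have hNpos : (0 : ℝ) < N := by exact_mod_cast hN1
      have h1 : ∑ l ∈ Finset.range (2 * N), ((l + 1 : ℕ) : ℝ) ^ ((1 : ℝ) - 2)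
          = (harmonic (2 * N) : ℝ) := by
        rw [harmonic]
        push_cast
        refine Finset.sum_congr rfl fun l _ => ?_
        rw [show (1 : ℝ) - 2 = -1 by norm_num, Real.rpow_neg_one]
      have h2 := harmonic_le_one_add_log (2 * N)
      rw [← h1] at h2
      push_cast at h2
      rw [Real.log_mul two_ne_zero hNpos.ne'] at h2
      have h3 : 0 ≤ Real.log 2 := Real.log_nonneg one_le_two
      rw [Real.norm_of_nonneg (Finset.sum_nonneg fun l _ => by positivity),
        Real.norm_of_nonneg (by linarith)]
      push_cast
      linarith
    filter_upwards [ae_isLittleO hA1 hA2 hA4 (s := 2) one_le_two (by rw [hd]; norm_num) hG hG']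
      with ω hω
    have h1 := (isBigO_refl (fun n : ℕ => (n : ℝ) ^ (-2 : ℤ)) atTop).mul_isLittleO hω
    refine h1.congr' ?_ EventuallyEq.rfl
    filter_upwards [eventually_ge_atTop 1] with n hn
    have hn0 : (n : ℝ) ≠ 0 := by exact_mod_cast (by omega : n ≠ 0)
    rw [← mul_assoc, zpow_neg, zpow_ofNat, inv_mul_cancel₀ (pow_ne_zero 2 hn0), one_mul]
  · have hd' : (5 / 2 : ℝ) ≤ (d : ℝ) / 2 := by
      have : (5 : ℝ) ≤ d := by exact_mod_cast hd
      linarith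
    have hG' : (fun N : ℕ => (N : ℝ) ^ ((2 : ℝ) - 5 / 2)) =o[atTop] fun _ : ℕ => (1 : ℝ) := by
      rw [isLittleO_one_iff]
      have := (tendsto_rpow_neg_atTop (y := 1 / 2) (by norm_num)).comp
        (tendsto_natCast_atTop_atTop (R := ℝ))
      convert this using 2
      norm_num
    have hG : (fun N : ℕ => ∑ l ∈ Finset.range (2 * N), ((l + 1 : ℕ) : ℝ) ^ ((1 : ℝ) - 5 / 2))
        =O[atTop] fun _ : ℕ => (1 : ℝ) := by
      have hsum : Summable fun l : ℕ => ((l + 1 : ℕ) : ℝ) ^ ((1 : ℝ) - 5 / 2) :=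
        (summable_nat_add_iff 1).2 (Real.summable_nat_rpow.2 (by norm_num))
      refine IsBigO.of_bound (∑' l : ℕ, ((l + 1 : ℕ) : ℝ) ^ ((1 : ℝ) - 5 / 2)) ?_
      refine Eventually.of_forall fun N => ?_
      rw [norm_one, mul_one, Real.norm_of_nonneg (Finset.sum_nonneg fun l _ => by positivity)]
      exact hsum.sum_le_tsum _ fun l _ => by positivity
    filter_upwards [ae_isLittleO hA1 hA2 hA4 (s := 5 / 2) (by norm_num) hd' hG hG'] with ω hω
    exact (isLittleO_one_iff ℝ).1 hω
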